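/- Let $\theta\in\mathbb R$, let $A=\mathcal O_\theta(\mathbb T^2)$ be the complex algebra generated by invertible elements $u,v$ with $vu=e^{i\theta}uv$, let $H=\mathcal O(U(1))=\mathbb C[t,t^{-1}]$ be the Hopf algebra in which $t$ is group-like, and let $\Delta_A\colon A\to A\otimes H$ be the coaction by algebra morphisms with $u\mapsto u\otimes t$, $v\mapsto v\otimes t^{-1}$. Put $B=A^{\mathrm{co}H}=\{a\in A:\Delta_A(a)=a\otimes 1\}$. On $H$ consider the classical calculus $\Omega^\bullet(H)=H\oplus\Omega^1(H)$, where $\Omega^1(H)$ is the free left $H$-module on $\mathrm dt$, $\mathrm dt\,t=t\,\mathrm dt$, and $\Omega^k(H)=0$ for $k>1$. On $A$ consider the differential calculus $\Omega^\bullet(A)=A\oplus\Omega^1(A)\oplus\Omega^2(A)$, where $\Omega^1(A)$ and $\Omega^2(A)$ are the free left $A$-modules on $\mathrm du,\mathrm dv$ and on $\mathrm du\wedge\mathrm dv$, with the relations $$\mathrm du\,u=u\,\mathrm du,\quad \mathrm dv\,v=v\,\mathrm dv,\quad \mathrm du\,v=e^{-i\theta}v\,\mathrm du,\quad \mathrm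 dv\,u=e^{i\theta}u\,\mathrm dv,$$ $$\mathrm du\wedge\mathrm dv+e^{-i\theta}\mathrm dv\wedge\mathrm du=0,\quad \mathrm du\wedge\mathrm du=0,\quad \mathrm dv\wedge\mathrm dv=0,$$ and $\Omega^k(A)=0$ for $k>2$. Then $\Omega^\bullet(H)$ is bicovariant, and $\Omega^\bullet(A)$ is complete, that is, $\Delta_A$ extends to a morphism $\Delta_A^\bullet\colon\Omega^\bullet(A)\to\Omega^\bullet(A)\otimes\Omega^\bullet(H)$ of differential graded algebras, where the right-hand side carries the graded tensor product algebra structure and the tensor product differential. Moreover: 1. The base forms $\Omega^\bullet(B)=\{\omega\in\Omega^\bullet(A):\Delta_A^\bullet(\omega)=\omega\otimes1\}$ are the pullback calculus on $B$: they form a differential graded subalgebra of $\Omega^\bullet(A)$ with degree-$0$ part $B$, and for every $n$ their degree-$n$ part is the span of all $b^0\mathrm db^1\wedge\cdots\wedge\mathrm db^n$ with $b^0,\dots,b^n\in B$. They vanish in degrees $n\ge2$, so $\Omega^\bullet(B)=B\oplus\Omega^1(B)$. 2. Let $\Lambda^\bullet\subseteq\Omega^\bullet(H)$ be the left $H$-coinvariant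 forms. Then $\Lambda^\bullet=\mathbb C\oplus\Lambda^1$ with $\Lambda^1=\mathrm{span}_{\mathbb C}\{t^{-1}\mathrm dt\}$, and hence the vertical forms $\mathrm{ver}^\bullet:=A\otimes\Lambda^\bullet$ are $A\otimes(\mathbb C\oplus\Lambda^1)$. The horizontal forms $\mathrm{hor}^\bullet:=(\Delta_A^\bullet)^{-1}(\Omega^\bullet(A)\otimes H)$ equal $A\,\Omega^\bullet(B)\,A$, the span of all products $a\,\beta\,a'$ with $a,a'\in A$, $\beta\in\Omega^\bullet(B)$. 3. The linear map $s\colon\Lambda^1\to\Omega^1(A)$ with $s(t^{-1}\mathrm dt)=u^{-1}\mathrm du$ is a connection $1$-form. That is, $s$ is right $H$-colinear, where $\Omega^1(A)$ carries the coaction given by the component of $\Delta_A^\bullet$ in $\Omega^1(A)\otimes H$, and $\Lambda^1$ carries the adjoint coaction $\varpi(h)\mapsto\varpi(h_2)\otimes S(h_1)h_3$ with $\varpi(h)=S(h_1)\mathrm d(h_2)$; and $\pi_v(s(\vartheta))=1\otimes\vartheta$ for all $\vartheta\in\Lambda^1$, where $\pi_v\colon\Omega^\bullet(A)\to A\otimes\Lambda^\bullet$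 is the component of $\Delta_A^\bullet$ in $A\otimes\Omega^\bullet(H)$ followed by $\mathrm{id}\otimes\pi_\Lambda$, $\pi_\Lambda(\omega)=S(\omega_{-1})\omega_0$, and $\omega\mapsto\omega_{-1}\otimes\omega_0$ is the left $H$-coaction on $\Omega^\bullet(H)$. -/

import Mathlib

open scoped TensorProduct LaurentPolynomial

noncomputable section

/-! ## Differential calculi and complete calculi -/

namespace NCTorus

/-- A differential calculus `Ω` on an algebra `A`: a differential graded algebra whose
degree `0` part is `A` and which is generated by `A`, so that `Ωⁿ` is spanned by the products
`a⁰ da¹ ∧ ⋯ ∧ daⁿ`. -/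
structure DifferentialCalculus (K A Ω : Type*) [Field K] [Ring A] [Algebra K A]
    [Ring Ω] [Algebra K Ω] where
  /-- the forms of degree `n` -/
  grade : ℕ → Submodule K Ω
  [graded : GradedAlgebra grade]
  /-- the differential -/
  d : Ω →ₗ[K] Ω
  d_mem : ∀ n, ∀ ω ∈ grade n, d ω ∈ grade (n + 1)
  d_d : ∀ ω, d (d ω) = 0
  leibniz : ∀ n, ∀ ω ∈ grade n, ∀ η, d (ω * η) = d ω * η + (-1 : K) ^ n • (ω * d η)
  /-- the identification of `A` with the forms of degree `0` -/
  zeroEquiv : A ≃ₐ[K] grade 0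
  generated : ∀ n, grade n = Submodule.span K {ω | ∃ (a₀ : A) (a : Fin n → A),
    ω = (zeroEquiv a₀ : Ω) * (List.ofFn fun i => d (zeroEquiv (a i) : Ω)).prod}

attribute [instance] DifferentialCalculus.graded

namespace DifferentialCalculus

variable {K A H Ω Ω' : Type*} [Field K] [Ring A] [Algebra K A] [Ring H] [Algebra K H]
  [Ring Ω] [Algebra K Ω] [Ring Ω'] [Algebra K Ω']

/-- The inclusion of `A` as the forms of degree `0`. -/
def incl (C : DifferentialCalculus K A Ω) : A →ₐ[K] Ω :=
  (SetLike.GradeZero.subalgebra C.grade).val.comp C.zeroEquiv.toAlgHom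

/-- The projection to the part of degree `0`, as an element of `A`. -/
def proj0 (C : DifferentialCalculus K A Ω) : Ω →ₗ[K] A :=
  C.zeroEquiv.symm.toLinearMap ∘ₗ DirectSum.component K ℕ (fun i => C.grade i) 0 ∘ₗ
    (DirectSum.decomposeLinearEquiv C.grade).toLinearMap

/-- The linear map `ω ↦ (-1) ^ |ω| ω` (for homogeneous `ω`). -/
def signMap (C : DifferentialCalculus K A Ω) : Ω →ₗ[K] Ω :=
  DirectSum.toModule K ℕ Ω (fun i => (-1 : K) ^ i • (C.grade i).subtype) ∘ₗ
    (DirectSum.decomposeLinearEquiv C.grade).toLinearMap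

/-- The tensor product of two calculi as an algebra, with the product
`(ω ⊗ ω') ∧ (η ⊗ η') = (-1) ^ (|ω'| |η|) (ω ∧ η) ⊗ (ω' ∧ η')`. -/
abbrev Tensor (C : DifferentialCalculus K A Ω) (D : DifferentialCalculus K H Ω') : Type _ :=
  GradedTensorProduct K C.grade D.grade

/-- The part of degree `n` of the tensor product of two calculi. -/
def tensorGrade (C : DifferentialCalculus K A Ω) (D : DifferentialCalculus K H Ω') (n : ℕ) :
    Submodule K (C.Tensor D) :=
  Submodule.span K {x | ∃ i j, i + j = n ∧ ∃ ω ∈ C.grade i, ∃ ω' ∈ D.grade j,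
    x = GradedTensorProduct.of K C.grade D.grade (ω ⊗ₜ[K] ω')}

/-- The differential `ω ⊗ ω' ↦ dω ⊗ ω' + (-1) ^ |ω| ω ⊗ dω'` of the tensor product. -/
def tensorD (C : DifferentialCalculus K A Ω) (D : DifferentialCalculus K H Ω') :
    C.Tensor D →ₗ[K] C.Tensor D :=
  (GradedTensorProduct.of K C.grade D.grade).toLinearMap ∘ₗ
    (TensorProduct.map C.d LinearMap.id + TensorProduct.map C.signMap D.d) ∘ₗ
      (GradedTensorProduct.of K C.grade D.grade).symm.toLinearMap

/-- `F : Ω(A) → Ω(A) ⊗ Ω(H)` is a morphism of differential graded algebras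
which extends `Δ : A → A ⊗ H`. -/
structure IsCoactionExtension (C : DifferentialCalculus K A Ω) (D : DifferentialCalculus K H Ω')
    (Δ : A →ₐ[K] A ⊗[K] H) (F : Ω →ₐ[K] C.Tensor D) : Prop where
  extend : ∀ a, F (C.incl a) = GradedTensorProduct.of K C.grade D.grade
    (TensorProduct.map C.incl.toLinearMap D.incl.toLinearMap (Δ a))
  map_grade : ∀ n, ∀ ω ∈ C.grade n, F ω ∈ C.tensorGrade D n
  map_d : ∀ ω, F (C.d ω) = C.tensorD D (F ω)

/-- A calculus on `A` is complete (with respect to the coaction `Δ : A → A ⊗ H` and the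
calculus `D` on `H`) if `Δ` extends to a morphism `Ω(A) → Ω(A) ⊗ Ω(H)` of differential graded
algebras. -/
def IsComplete (C : DifferentialCalculus K A Ω) (D : DifferentialCalculus K H Ω')
    (Δ : A →ₐ[K] A ⊗[K] H) : Prop :=
  ∃ F : Ω →ₐ[K] C.Tensor D, C.IsCoactionExtension D Δ F

section Forms

variable {C : DifferentialCalculus K A Ω} {D : DifferentialCalculus K H Ω'}

/-- The horizontal forms: the preimage of `Ω(A) ⊗ H` under `F : Ω(A) → Ω(A) ⊗ Ω(H)`. -/
def horizontalForms (F : Ω →ₐ[K] C.Tensor D) : Submodule K Ω :=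
  (LinearMap.range ((GradedTensorProduct.of K C.grade D.grade).toLinearMap ∘ₗ
    TensorProduct.map LinearMap.id (D.grade 0).subtype)).comap F.toLinearMap

/-- The base forms: the forms `ω` with `F ω = ω ⊗ 1`. -/
def baseForms (F : Ω →ₐ[K] C.Tensor D) : Subalgebra K Ω :=
  AlgHom.equalizer F (GradedTensorProduct.includeLeft C.grade D.grade)

/-- The right `H`-coaction on `Ω(A)`: the component of `F` in `Ω(A) ⊗ H`. -/
def rightCoaction (F : Ω →ₐ[K] C.Tensor D) : Ω →ₗ[K] Ω ⊗[K] H :=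
  TensorProduct.map LinearMap.id D.proj0 ∘ₗ
    (GradedTensorProduct.of K C.grade D.grade).symm.toLinearMap ∘ₗ F.toLinearMap

end Forms

/-- The subalgebra of coinvariants `{a | Δ a = a ⊗ 1}`. -/
def coinvariants (Δ : A →ₐ[K] A ⊗[K] H) : Subalgebra K A :=
  AlgHom.equalizer Δ Algebra.TensorProduct.includeLeft

/-- The span of all `b⁰ db¹ ∧ ⋯ ∧ dbⁿ` with `b⁰, …, bⁿ` in a subalgebra `B` of `A`. -/
def pullbackForms (C : DifferentialCalculus K A Ω) (B : Subalgebra K A) (n : ℕ) :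
    Submodule K Ω :=
  Submodule.span K {ω | ∃ b₀ ∈ B, ∃ b : Fin n → A, (∀ i, b i ∈ B) ∧
    ω = C.incl b₀ * (List.ofFn fun i => C.d (C.incl (b i))).prod}

/-- The subalgebra `S` of `Ω(A)` is the pullback calculus on `B`: it is a differential graded
subalgebra generated by `B`, with `B` as its part of degree `0`. -/
structure IsPullbackCalculus (C : DifferentialCalculus K A Ω) (B : Subalgebra K A)
    (S : Subalgebra K Ω) : Prop where
  homogeneous : ∀ ω ∈ S, ∀ n, (DirectSum.decompose C.grade ω n : Ω) ∈ S
  d_mem : ∀ ω ∈ S, C.d ω ∈ S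
  degree_zero : Subalgebra.toSubmodule S ⊓ C.grade 0 =
    (Subalgebra.toSubmodule B).map C.incl.toLinearMap
  generated : ∀ n, Subalgebra.toSubmodule S ⊓ C.grade n = C.pullbackForms B n

end DifferentialCalculus

namespace DifferentialCalculus

variable {K A H Ω Ω' : Type*} [Field K] [Ring A] [Algebra K A] [Ring H] [HopfAlgebra K H]
  [Ring Ω] [Algebra K Ω] [Ring Ω'] [Algebra K Ω']
  {C : DifferentialCalculus K A Ω} {D : DifferentialCalculus K H Ω'}

/-- `L : Ω(H) → H ⊗ Ω(H)` is the left `H`-coaction of a left covariant calculus: a graded coaction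
which is an algebra morphism, extends the comultiplication and commutes with `d`. -/
structure IsLeftCoaction (D : DifferentialCalculus K H Ω') (L : Ω' →ₐ[K] H ⊗[K] Ω') : Prop where
  extend : ∀ h, L (D.incl h) =
    TensorProduct.map LinearMap.id D.incl.toLinearMap (Coalgebra.comul (R := K) h)
  map_d : ∀ ω, L (D.d ω) = TensorProduct.map LinearMap.id D.d (L ω)
  map_grade : ∀ n, ∀ ω ∈ D.grade n,
    L ω ∈ LinearMap.range (TensorProduct.map (LinearMap.id (R := K) (M := H)) (D.grade n).subtype)
  coassoc : ∀ ω, TensorProduct.assoc K H H Ω'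
      (TensorProduct.map (Coalgebra.comul (R := K)) LinearMap.id (L ω)) =
    TensorProduct.map LinearMap.id L.toLinearMap (L ω)
  counit : ∀ ω, TensorProduct.lid K Ω'
    (TensorProduct.map (Coalgebra.counit (R := K)) LinearMap.id (L ω)) = ω

/-- `R : Ω(H) → Ω(H) ⊗ H` is the right `H`-coaction of a right covariant calculus. -/
structure IsRightCoaction (D : DifferentialCalculus K H Ω') (R : Ω' →ₐ[K] Ω' ⊗[K] H) : Prop where
  extend : ∀ h, R (D.incl h) =
    TensorProduct.map D.incl.toLinearMap LinearMap.id (Coalgebra.comul (R := K) h)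
  map_d : ∀ ω, R (D.d ω) = TensorProduct.map D.d LinearMap.id (R ω)
  map_grade : ∀ n, ∀ ω ∈ D.grade n,
    R ω ∈ LinearMap.range (TensorProduct.map (D.grade n).subtype (LinearMap.id (R := K) (M := H)))
  coassoc : ∀ ω, TensorProduct.assoc K Ω' H H
      (TensorProduct.map R.toLinearMap LinearMap.id (R ω)) =
    TensorProduct.map LinearMap.id (Coalgebra.comul (R := K)) (R ω)
  counit : ∀ ω, TensorProduct.rid K Ω'
    (TensorProduct.map LinearMap.id (Coalgebra.counit (R := K)) (R ω)) = ω

/-- A calculus on `H` is bicovariant if it is left and right covariant. -/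
def IsBicovariant (D : DifferentialCalculus K H Ω') : Prop :=
  (∃ L, D.IsLeftCoaction L) ∧ ∃ R, D.IsRightCoaction R

/-- The left coinvariant forms `Λⁿ` of degree `n`, with respect to the left coaction `L`. -/
def leftCoinvariants (D : DifferentialCalculus K H Ω') (L : Ω' →ₐ[K] H ⊗[K] Ω') (n : ℕ) :
    Submodule K Ω' :=
  D.grade n ⊓ LinearMap.eqLocus L.toLinearMap (TensorProduct.mk K H Ω' 1)

/-- The Cartan–Maurer form `h ↦ S(h₁) d(h₂)`. -/
def cartanMaurer (D : DifferentialCalculus K H Ω') : H →ₗ[K] Ω' :=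
  LinearMap.mul' K Ω' ∘ₗ
    TensorProduct.map (D.incl.toLinearMap ∘ₗ HopfAlgebra.antipode K) (D.d ∘ₗ D.incl.toLinearMap) ∘ₗ
      Coalgebra.comul

/-- The projection `ω ↦ S(ω₋₁) ω₀` of `Ω(H)` onto the left coinvariant forms. -/
def coinvariantProj (D : DifferentialCalculus K H Ω') (L : Ω' →ₐ[K] H ⊗[K] Ω') : Ω' →ₗ[K] Ω' :=
  LinearMap.mul' K Ω' ∘ₗ
    TensorProduct.map (D.incl.toLinearMap ∘ₗ HopfAlgebra.antipode K) LinearMap.id ∘ₗ L.toLinearMap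

/-- The vertical forms `verⁿ = A ⊗ Λⁿ` of degree `n`, as a subspace of `A ⊗ Ω(H)`. -/
def verticalForms (A : Type*) [Ring A] [Algebra K A] (D : DifferentialCalculus K H Ω')
    (L : Ω' →ₐ[K] H ⊗[K] Ω') (n : ℕ) : Submodule K (A ⊗[K] Ω') :=
  LinearMap.range
    (TensorProduct.map (LinearMap.id (R := K) (M := A)) (D.leftCoinvariants L n).subtype)

/-- The projection of total space forms to vertical forms: the component of `F`
in `A ⊗ Ω(H)`, followed by the projection of `Ω(H)` onto the left coinvariant forms. -/
def verticalProj (F : Ω →ₐ[K] C.Tensor D) (L : Ω' →ₐ[K] H ⊗[K] Ω') : Ω →ₗ[K] A ⊗[K] Ω' :=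
  TensorProduct.map C.proj0 (D.coinvariantProj L) ∘ₗ
    (GradedTensorProduct.of K C.grade D.grade).symm.toLinearMap ∘ₗ F.toLinearMap

/-- The adjoint coaction `h ↦ h₂ ⊗ S(h₁) h₃` of `H`. -/
def adjoint (K H : Type*) [Field K] [Ring H] [HopfAlgebra K H] : H →ₗ[K] H ⊗[K] H :=
  TensorProduct.map LinearMap.id
      (LinearMap.mul' K H ∘ₗ TensorProduct.map (HopfAlgebra.antipode K) LinearMap.id) ∘ₗ
    (TensorProduct.leftComm K H H H).toLinearMap ∘ₗ
      TensorProduct.map LinearMap.id Coalgebra.comul ∘ₗ Coalgebra.comul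

/-- `ad` is the adjoint coaction `Λ¹ → Λ¹ ⊗ H`, `ϖ(h) ↦ ϖ(h₂) ⊗ S(h₁) h₃`, where `ϖ` is the
Cartan–Maurer form. -/
def IsAdjointCoaction (D : DifferentialCalculus K H Ω') (L : Ω' →ₐ[K] H ⊗[K] Ω')
    (ad : D.leftCoinvariants L 1 →ₗ[K] D.leftCoinvariants L 1 ⊗[K] H) : Prop :=
  ∀ (ϑ : D.leftCoinvariants L 1) (h : H), (ϑ : Ω') = D.cartanMaurer h →
    TensorProduct.map (D.leftCoinvariants L 1).subtype LinearMap.id (ad ϑ) =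
      TensorProduct.map D.cartanMaurer LinearMap.id (adjoint K H h)

/-- A connection `1`-form: a linear map `s : Λ¹ → Ω¹(A)`, colinear for the adjoint coaction on
`Λ¹`, whose composition with the projection to vertical forms is `ϑ ↦ 1 ⊗ ϑ`. -/
structure IsConnectionForm (F : Ω →ₐ[K] C.Tensor D) (L : Ω' →ₐ[K] H ⊗[K] Ω')
    (s : D.leftCoinvariants L 1 →ₗ[K] C.grade 1) : Prop where
  colinear : ∃ ad, D.IsAdjointCoaction L ad ∧ ∀ ϑ,
    rightCoaction F (s ϑ) = TensorProduct.map ((C.grade 1).subtype ∘ₗ s) LinearMap.id (ad ϑ)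
  splits : ∀ ϑ, verticalProj F L (s ϑ) = 1 ⊗ₜ[K] (ϑ : Ω')

end DifferentialCalculus

end NCTorus

/-! ## The noncommutative torus algebra -/

namespace NCTorus

/-- The phase `q = exp (i θ)`. -/
def phase (θ : ℝ) : ℂ := Complex.exp (Complex.I * θ)

theorem phase_ne_zero (θ : ℝ) : phase θ ≠ 0 := Complex.exp_ne_zero _

/-- The noncommutative algebraic `2`-torus: the complex vector space with basis the
ordered monomials `u ^ m v ^ n`, `m n : ℤ`. The product is the one forced by `v u = exp (i θ) u v`.
By `Torus.existsUnique_lift` this is the algebra generated by two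
invertible elements `u`, `v` subject to the relation `v u = exp (i θ) u v`. -/
def Torus (_θ : ℝ) : Type := (ℤ × ℤ) →₀ ℂ

namespace Torus

variable {θ : ℝ}

instance : AddCommGroup (Torus θ) := inferInstanceAs (AddCommGroup ((ℤ × ℤ) →₀ ℂ))
instance : Module ℂ (Torus θ) := inferInstanceAs (Module ℂ ((ℤ × ℤ) →₀ ℂ))

/-- The monomials `u ^ m v ^ n` form a basis. -/
def basis (θ : ℝ) : Module.Basis (ℤ × ℤ) ℂ (Torus θ) := ⟨LinearEquiv.refl ℂ ((ℤ × ℤ) →₀ ℂ)⟩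

/-- The monomial `u ^ m v ^ n`. -/
def mono (m n : ℤ) : Torus θ := basis θ (m, n)

theorem lin_ext {M : Type*} [AddCommGroup M] [Module ℂ M] {f g : Torus θ →ₗ[ℂ] M}
    (h : ∀ m n, f (mono m n) = g (mono m n)) : f = g :=
  (basis θ).ext fun p => h p.1 p.2

/-- The linear map with prescribed values on the monomials. -/
def ofMono {M : Type*} [AddCommGroup M] [Module ℂ M] (F : ℤ → ℤ → M) : Torus θ →ₗ[ℂ] M :=
  (basis θ).constr ℂ fun p => F p.1 p.2

@[simp] theorem ofMono_mono {M : Type*} [AddCommGroup M] [Module ℂ M] (F : ℤ → ℤ → M) (m n : ℤ) :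
    (ofMono F : Torus θ →ₗ[ℂ] M) (mono m n) = F m n := by
  simp [ofMono, mono]

/-- The product: `u ^ a v ^ b · u ^ c v ^ d = q ^ (b c) u ^ (a + c) v ^ (b + d)`. -/
def mulHom (θ : ℝ) : Torus θ →ₗ[ℂ] Torus θ →ₗ[ℂ] Torus θ :=
  ofMono fun a b => ofMono fun c d => phase θ ^ (b * c) • mono (a + c) (b + d)

instance : Mul (Torus θ) := ⟨fun x y => mulHom θ x y⟩
instance : One (Torus θ) := ⟨mono 0 0⟩

theorem one_eq : (1 : Torus θ) = mono 0 0 := rfl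
theorem mul_eq (x y : Torus θ) : x * y = mulHom θ x y := rfl

@[simp] theorem mono_mul_mono (a b c d : ℤ) :
    (mono a b * mono c d : Torus θ) = phase θ ^ (b * c) • mono (a + c) (b + d) := by
  simp [mul_eq, mulHom]

protected theorem smul_mul_aux (r : ℂ) (x y : Torus θ) : r • x * y = r • (x * y) := by
  simp [mul_eq]

protected theorem mul_smul_aux (r : ℂ) (x y : Torus θ) : x * r • y = r • (x * y) := by
  simp [mul_eq]

protected theorem mul_assoc_aux (x y z : Torus θ) : x * y * z = x * (y * z) := by
  have h : (mulHom θ).compr₂ (mulHom θ) =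
      (LinearMap.lcomp ℂ (Torus θ →ₗ[ℂ] Torus θ) (mulHom θ)) ∘ₗ
        (LinearMap.llcomp ℂ (Torus θ) (Torus θ) (Torus θ)) ∘ₗ mulHom θ := by
    refine lin_ext fun a b => lin_ext fun c d => lin_ext fun e f => ?_
    change mono a b * mono c d * mono e f = mono a b * (mono c d * mono e f)
    simp only [mono_mul_mono, Torus.smul_mul_aux, Torus.mul_smul_aux, smul_smul, add_assoc]
    congr 1
    rw [← zpow_add₀ (phase_ne_zero θ), ← zpow_add₀ (phase_ne_zero θ)]
    congr 1
    ring
  exact LinearMap.congr_fun (LinearMap.congr_fun (LinearMap.congr_fun h x) y) z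

protected theorem one_mul_aux (x : Torus θ) : 1 * x = x := by
  have h : mulHom θ 1 = LinearMap.id := by
    refine lin_ext fun a b => ?_
    simp [← mul_eq, one_eq]
  exact LinearMap.congr_fun h x

protected theorem mul_one_aux (x : Torus θ) : x * 1 = x := by
  have h : (mulHom θ).flip 1 = LinearMap.id := by
    refine lin_ext fun a b => ?_
    simp [← mul_eq, one_eq]
  exact LinearMap.congr_fun h x

instance : Ring (Torus θ) :=
  { (inferInstance : AddCommGroup (Torus θ)) with
    mul := (· * ·)
    one := 1
    left_distrib := fun x y z => by simp [mul_eq]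
    right_distrib := fun x y z => by simp [mul_eq]
    zero_mul := fun x => by simp [mul_eq]
    mul_zero := fun x => by simp [mul_eq]
    mul_assoc := Torus.mul_assoc_aux
    one_mul := Torus.one_mul_aux
    mul_one := Torus.mul_one_aux }

instance : Algebra ℂ (Torus θ) := Algebra.ofModule Torus.smul_mul_aux Torus.mul_smul_aux

/-- The generator `u`. -/
def u : (Torus θ)ˣ where
  val := mono 1 0
  inv := mono (-1) 0
  val_inv := by simp [one_eq]
  inv_val := by simp [one_eq]

/-- The generator `v`. -/
def v : (Torus θ)ˣ where
  val := mono 0 1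
  inv := mono 0 (-1)
  val_inv := by simp [one_eq]
  inv_val := by simp [one_eq]

theorem v_mul_u :
    ((v : (Torus θ)ˣ) : Torus θ) * (u : (Torus θ)ˣ) =
      phase θ • (((u : (Torus θ)ˣ) : Torus θ) * (v : (Torus θ)ˣ)) := by
  simp [u, v]

theorem u_zpow (m : ℤ) : ((u ^ m : (Torus θ)ˣ) : Torus θ) = mono m 0 := by
  induction m using Int.induction_on with
  | zero => simp [one_eq]
  | succ n ih => rw [zpow_add_one, Units.val_mul, ih]; simp [u]
  | pred n ih => rw [zpow_sub_one, Units.val_mul, ih]; simp [u, sub_eq_add_neg]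

theorem v_zpow (m : ℤ) : ((v ^ m : (Torus θ)ˣ) : Torus θ) = mono 0 m := by
  induction m using Int.induction_on with
  | zero => simp [one_eq]
  | succ n ih => rw [zpow_add_one, Units.val_mul, ih]; simp [v]
  | pred n ih => rw [zpow_sub_one, Units.val_mul, ih]; simp [v, sub_eq_add_neg]

theorem mono_eq (m n : ℤ) : (mono m n : Torus θ) =
    ((u ^ m : (Torus θ)ˣ) : Torus θ) * ((v ^ n : (Torus θ)ˣ) : Torus θ) := by
  simp [u_zpow, v_zpow]

theorem algHom_ext' {R : Type*} [Ring R] [Algebra ℂ R] {f g : Torus θ →ₐ[ℂ] R}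
    (hu : f (u : (Torus θ)ˣ) = g (u : (Torus θ)ˣ))
    (hv : f (v : (Torus θ)ˣ) = g (v : (Torus θ)ˣ)) : f = g := by
  have key : ∀ (w : (Torus θ)ˣ) (n : ℤ), f w = g w → f ↑(w ^ n) = g ↑(w ^ n) := by
    intro w n h
    have : Units.map (f : Torus θ →* R) w = Units.map (g : Torus θ →* R) w := Units.ext h
    have h2 := congrArg (fun z : Rˣ => ((z ^ n : Rˣ) : R)) this
    simpa [← map_zpow] using h2
  apply AlgHom.toLinearMap_injective
  refine lin_ext fun m n => ?_
  simp [mono_eq, key _ _ hu, key _ _ hv]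

/-- An algebra homomorphism from its values on monomials. -/
def homOfMono {R : Type*} [Ring R] [Algebra ℂ R] (F : ℤ → ℤ → R) (h1 : F 0 0 = 1)
    (hm : ∀ a b c d, phase θ ^ (b * c) • F (a + c) (b + d) = F a b * F c d) :
    Torus θ →ₐ[ℂ] R :=
  AlgHom.ofLinearMap (ofMono F) (by simp [one_eq, h1]) (by
    rw [LinearMap.map_mul_iff]
    refine lin_ext fun a b => lin_ext fun c d => ?_
    simp [hm])

@[simp] theorem homOfMono_mono {R : Type*} [Ring R] [Algebra ℂ R] (F : ℤ → ℤ → R) (h1 : F 0 0 = 1)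
    (hm : ∀ a b c d, phase θ ^ (b * c) • F (a + c) (b + d) = F a b * F c d) (m n : ℤ) :
    homOfMono (θ := θ) F h1 hm (mono m n) = F m n :=
  ofMono_mono F m n

/-- Universal property: the torus is the complex algebra generated by two invertible
elements `u`, `v` subject to the relation `v u = exp (i θ) u v`. -/
theorem existsUnique_lift {R : Type*} [Ring R] [Algebra ℂ R] (U V : Rˣ)
    (h : (V * U : R) = phase θ • (U * V : R)) :
    ∃! f : Torus θ →ₐ[ℂ] R, f (u : (Torus θ)ˣ) = U ∧ f (v : (Torus θ)ˣ) = V := by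
  let Q : Rˣ := Units.map (algebraMap ℂ R : ℂ →* R) (Units.mk0 (phase θ) (phase_ne_zero θ))
  have hQc : ∀ x : Rˣ, Commute Q x := fun x => Units.ext (Algebra.commutes (phase θ) (x : R))
  have hQ : ∀ k : ℤ, ((Q ^ k : Rˣ) : R) = algebraMap ℂ R (phase θ ^ k) := by
    intro k
    change ((Units.map (algebraMap ℂ R : ℂ →* R) (Units.mk0 (phase θ) (phase_ne_zero θ)) ^ k : Rˣ) : R) = _
    rw [← map_zpow, Units.coe_map]
    simp
  have hVU : V * U = Q * U * V := by
    apply Units.ext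
    simp [h, Q, mul_assoc, Algebra.smul_def]
  have h1 : ∀ c : ℤ, V * U ^ c = Q ^ c * U ^ c * V := by
    intro c
    have h2 : V * U * V⁻¹ = Q * U := by rw [hVU]; group
    have h3 : V * U ^ c * V⁻¹ = (Q * U) ^ c := by rw [← h2, conj_zpow]
    rw [(hQc U).mul_zpow] at h3
    rw [← h3]; group
  have h2 : ∀ b c : ℤ, V ^ b * U ^ c = Q ^ (b * c) * U ^ c * V ^ b := by
    intro b c
    have h4 : U ^ (-c) * V * U ^ c = Q ^ c * V := by
      rw [mul_assoc, h1, ← mul_assoc, ← mul_assoc, ((hQc (U ^ (-c))).zpow_left c).symm.eq]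
      group
    have h5 : U ^ (-c) * V ^ b * U ^ c = (Q ^ c * V) ^ b := by
      rw [← h4]
      have h6 := conj_zpow (i := b) (a := U ^ (-c)) (b := V)
      rw [← zpow_neg, neg_neg] at h6
      exact h6.symm
    rw [((hQc V).zpow_left c).mul_zpow, ← zpow_mul, mul_comm c b] at h5
    have h6 : V ^ b * U ^ c = U ^ c * (U ^ (-c) * V ^ b * U ^ c) := by group
    rw [h6, h5, ← mul_assoc, ((hQc (U ^ c)).zpow_left _).eq]
  refine ⟨homOfMono (fun m n => ((U ^ m * V ^ n : Rˣ) : R)) (by simp) ?_, ⟨?_, ?_⟩, ?_⟩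
  · intro a b c d
    rw [Algebra.smul_def, ← hQ, ← Units.val_mul, ← Units.val_mul]
    congr 1
    have : U ^ a * V ^ b * (U ^ c * V ^ d) = U ^ a * (V ^ b * U ^ c) * V ^ d := by group
    rw [this, h2, zpow_add, zpow_add, ← mul_assoc, ← mul_assoc, ← mul_assoc, ← mul_assoc,
      ((hQc (U ^ a)).zpow_left (b * c)).eq, mul_assoc (U ^ a) _ (U ^ c)]
  · change homOfMono _ _ _ (mono 1 0) = _
    simp
  · change homOfMono _ _ _ (mono 0 1) = _
    simp
  · rintro g ⟨hu, hv⟩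
    refine algHom_ext' ?_ ?_
    · rw [hu]; change _ = homOfMono _ _ _ (mono 1 0); simp
    · rw [hv]; change _ = homOfMono _ _ _ (mono 0 1); simp

/-- The automorphism `u ↦ x u`, `v ↦ y v`, for nonzero complex numbers `x`, `y`. -/
def scale (x y : ℂˣ) : Torus θ →ₐ[ℂ] Torus θ :=
  homOfMono (fun m n => ((x ^ m * y ^ n : ℂˣ) : ℂ) • mono m n) (by simp [one_eq]) (by
    intro a b c d
    simp only [smul_mul_smul_comm, mono_mul_mono, smul_smul, zpow_add, Units.val_mul]
    congr 1
    ring)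

@[simp] theorem scale_mono (x y : ℂˣ) (m n : ℤ) :
    scale x y (mono m n : Torus θ) = ((x ^ m * y ^ n : ℂˣ) : ℂ) • mono m n := by
  simp [scale]

end Torus
end NCTorus

/-! ## Forms on the noncommutative torus -/

namespace NCTorus

variable {θ : ℝ}

/-- A form `a + f du + g dv + h du ∧ dv`, with coefficients in the torus algebra. -/
@[ext] structure TorusForms (θ : ℝ) : Type where
  /-- the part of degree `0` -/
  c : Torus θ
  /-- the coefficient of `du` -/
  cu : Torus θ
  /-- the coefficient of `dv` -/
  cv : Torus θ
  /-- the coefficient of `du ∧ dv` -/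
  cuv : Torus θ

namespace TorusForms

/-- The coefficients of a form. -/
def equivProd (θ : ℝ) : TorusForms θ ≃ Torus θ × Torus θ × Torus θ × Torus θ where
  toFun ω := (ω.c, ω.cu, ω.cv, ω.cuv)
  invFun p := ⟨p.1, p.2.1, p.2.2.1, p.2.2.2⟩
  left_inv _ := rfl
  right_inv _ := rfl

instance : AddCommGroup (TorusForms θ) := (equivProd θ).addCommGroup
instance : Module ℂ (TorusForms θ) := (equivProd θ).module ℂ

@[simp] theorem add_c (x y : TorusForms θ) : (x + y).c = x.c + y.c := rfl
@[simp] theorem add_cu (x y : TorusForms θ) : (x + y).cu = x.cu + y.cu := rfl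
@[simp] theorem add_cv (x y : TorusForms θ) : (x + y).cv = x.cv + y.cv := rfl
@[simp] theorem add_cuv (x y : TorusForms θ) : (x + y).cuv = x.cuv + y.cuv := rfl
@[simp] theorem zero_c : (0 : TorusForms θ).c = 0 := rfl
@[simp] theorem zero_cu : (0 : TorusForms θ).cu = 0 := rfl
@[simp] theorem zero_cv : (0 : TorusForms θ).cv = 0 := rfl
@[simp] theorem zero_cuv : (0 : TorusForms θ).cuv = 0 := rfl
@[simp] theorem neg_c (x : TorusForms θ) : (-x).c = -x.c := rfl
@[simp] theorem neg_cu (x : TorusForms θ) : (-x).cu = -x.cu := rfl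
@[simp] theorem neg_cv (x : TorusForms θ) : (-x).cv = -x.cv := rfl
@[simp] theorem neg_cuv (x : TorusForms θ) : (-x).cuv = -x.cuv := rfl
@[simp] theorem smul_c (r : ℂ) (x : TorusForms θ) : (r • x).c = r • x.c := rfl
@[simp] theorem smul_cu (r : ℂ) (x : TorusForms θ) : (r • x).cu = r • x.cu := rfl
@[simp] theorem smul_cv (r : ℂ) (x : TorusForms θ) : (r • x).cv = r • x.cv := rfl
@[simp] theorem smul_cuv (r : ℂ) (x : TorusForms θ) : (r • x).cuv = r • x.cuv := rfl

/-- The phase as a unit of `ℂ`. -/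
def q (θ : ℝ) : ℂˣ := Units.mk0 (phase θ) (phase_ne_zero θ)

/-- The automorphism `σ` with `du a = σ(a) du`, that is `u ↦ u`, `v ↦ exp (- i θ) v`. -/
def twistU : Torus θ →ₐ[ℂ] Torus θ := Torus.scale 1 (q θ)⁻¹

/-- The automorphism `τ` with `dv a = τ(a) dv`, that is `u ↦ exp (i θ) u`, `v ↦ v`. -/
def twistV : Torus θ →ₐ[ℂ] Torus θ := Torus.scale (q θ) 1

theorem twist_comm (a : Torus θ) : twistV (twistU a) = twistU (twistV a) := by
  have h : (twistV.comp twistU : Torus θ →ₐ[ℂ] Torus θ).toLinearMap =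
      (twistU.comp twistV : Torus θ →ₐ[ℂ] Torus θ).toLinearMap := by
    refine Torus.lin_ext fun m n => ?_
    simp [twistU, twistV, smul_smul, mul_comm]
  exact LinearMap.congr_fun h a

/-- The wedge product: the left linear one determined by
`du a = σ(a) du`, `dv a = τ(a) dv`, `du ∧ du = dv ∧ dv = 0` and
`dv ∧ du = - exp (i θ) du ∧ dv`. -/
instance : Mul (TorusForms θ) where
  mul x y :=
    { c := x.c * y.c
      cu := x.c * y.cu + x.cu * twistU y.c
      cv := x.c * y.cv + x.cv * twistV y.c
      cuv := x.c * y.cuv + x.cu * twistU y.cv - phase θ • (x.cv * twistV y.cu)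
        + x.cuv * twistU (twistV y.c) }

instance : One (TorusForms θ) where
  one := ⟨1, 0, 0, 0⟩

@[simp] theorem one_c : (1 : TorusForms θ).c = 1 := rfl
@[simp] theorem one_cu : (1 : TorusForms θ).cu = 0 := rfl
@[simp] theorem one_cv : (1 : TorusForms θ).cv = 0 := rfl
@[simp] theorem one_cuv : (1 : TorusForms θ).cuv = 0 := rfl
@[simp] theorem mul_c (x y : TorusForms θ) : (x * y).c = x.c * y.c := rfl
@[simp] theorem mul_cu (x y : TorusForms θ) :
    (x * y).cu = x.c * y.cu + x.cu * twistU y.c := rfl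
@[simp] theorem mul_cv (x y : TorusForms θ) :
    (x * y).cv = x.c * y.cv + x.cv * twistV y.c := rfl
@[simp] theorem mul_cuv (x y : TorusForms θ) :
    (x * y).cuv = x.c * y.cuv + x.cu * twistU y.cv - phase θ • (x.cv * twistV y.cu)
      + x.cuv * twistU (twistV y.c) := rfl

instance : Ring (TorusForms θ) :=
  { (inferInstance : AddCommGroup (TorusForms θ)) with
    mul := (· * ·)
    one := 1
    left_distrib := fun x y z => by
      ext1 <;> simp only [mul_c, mul_cu, mul_cv, mul_cuv, add_c, add_cu, add_cv, add_cuv, mul_add,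
        map_add, smul_add] <;> abel
    right_distrib := fun x y z => by
      ext1 <;> simp only [mul_c, mul_cu, mul_cv, mul_cuv, add_c, add_cu, add_cv, add_cuv, add_mul,
        smul_add] <;> abel
    zero_mul := fun x => by ext1 <;> simp
    mul_zero := fun x => by ext1 <;> simp
    mul_assoc := fun x y z => by
      ext1 <;> simp only [mul_c, mul_cu, mul_cv, mul_cuv, add_mul, mul_add, sub_mul, mul_sub,
        map_add, map_sub, map_mul, map_smul, smul_add, smul_sub, twist_comm, mul_assoc,
        smul_mul_assoc, mul_smul_comm] <;> abel
    one_mul := fun x => by ext1 <;> simp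
    mul_one := fun x => by ext1 <;> simp }

instance : Algebra ℂ (TorusForms θ) :=
  Algebra.ofModule (fun r x y => by ext1 <;> simp [smul_comm r (phase θ), smul_sub])
    (fun r x y => by ext1 <;> simp [smul_comm r (phase θ), smul_sub])

/-- Functions as forms of degree `0`. -/
def ofTorus : Torus θ →ₐ[ℂ] TorusForms θ :=
  AlgHom.ofLinearMap
    { toFun := fun a => ⟨a, 0, 0, 0⟩
      map_add' := fun a b => by ext1 <;> simp
      map_smul' := fun r a => by ext1 <;> simp }
    rfl (fun a b => by ext1 <;> simp)

@[simp] theorem ofTorus_c (a : Torus θ) : (ofTorus a).c = a := rfl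
@[simp] theorem ofTorus_cu (a : Torus θ) : (ofTorus a).cu = 0 := rfl
@[simp] theorem ofTorus_cv (a : Torus θ) : (ofTorus a).cv = 0 := rfl
@[simp] theorem ofTorus_cuv (a : Torus θ) : (ofTorus a).cuv = 0 := rfl

/-- The coefficient of `du` in `da`: since `da = d(u ^ m) v ^ n + u ^ m d(v ^ n)` and
`du v ^ n = exp (- i n θ) v ^ n du`,
it is `m exp (- i n θ) u ^ (m - 1) v ^ n` for `a = u ^ m v ^ n`. -/
def partialU : Torus θ →ₗ[ℂ] Torus θ :=
  Torus.ofMono fun m n => (m * phase θ ^ (-n) : ℂ) • Torus.mono (m - 1) n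

/-- The coefficient of `dv` in `da`: it is `n u ^ m v ^ (n - 1)` for `a = u ^ m v ^ n`. -/
def partialV : Torus θ →ₗ[ℂ] Torus θ :=
  Torus.ofMono fun m n => (n : ℂ) • Torus.mono m (n - 1)

@[simp] theorem partialU_mono (m n : ℤ) : partialU (Torus.mono m n : Torus θ) =
    (m * phase θ ^ (-n) : ℂ) • Torus.mono (m - 1) n := Torus.ofMono_mono _ _ _

@[simp] theorem partialV_mono (m n : ℤ) : partialV (Torus.mono m n : Torus θ) =
    (n : ℂ) • Torus.mono m (n - 1) := Torus.ofMono_mono _ _ _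

/-- The differential: `da = ∂ᵤ(a) du + ∂ᵥ(a) dv` on functions, and
`d(f du + g dv) = df ∧ du + dg ∧ dv` on `1`-forms. -/
def d : TorusForms θ →ₗ[ℂ] TorusForms θ where
  toFun ω := ⟨0, partialU ω.c, partialV ω.c, partialU ω.cv - phase θ • partialV ω.cu⟩
  map_add' x y := by
    ext1 <;> simp only [add_c, add_cu, add_cv, add_cuv, map_add, smul_add] <;> abel
  map_smul' r x := by ext1 <;> simp [smul_comm r (phase θ), smul_sub]

@[simp] theorem d_c (ω : TorusForms θ) : (d ω).c = 0 := rfl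
@[simp] theorem d_cu (ω : TorusForms θ) : (d ω).cu = partialU ω.c := rfl
@[simp] theorem d_cv (ω : TorusForms θ) : (d ω).cv = partialV ω.c := rfl
@[simp] theorem d_cuv (ω : TorusForms θ) :
    (d ω).cuv = partialU ω.cv - phase θ • partialV ω.cu := rfl

theorem partialU_mul (a b : Torus θ) :
    partialU (a * b) = partialU a * twistU b + a * partialU b := by
  have h : (LinearMap.mul ℂ (Torus θ)).compr₂ partialU =
      (LinearMap.mul ℂ (Torus θ)).compl₁₂ partialU twistU.toLinearMap +
        (LinearMap.mul ℂ (Torus θ)).compl₂ partialU := by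
    refine Torus.lin_ext fun a b => Torus.lin_ext fun c e => ?_
    have h0 := phase_ne_zero θ
    simp only [LinearMap.compr₂_apply, LinearMap.mul_apply', LinearMap.add_apply,
      LinearMap.compl₁₂_apply, AlgHom.toLinearMap_apply, LinearMap.compl₂_apply,
      LinearMap.smul_apply, Torus.mono_mul_mono, map_smul, partialU_mono,
      twistU, Torus.scale_mono, smul_mul_smul_comm, smul_smul,
      mul_smul_comm, one_zpow, one_mul, inv_zpow', Units.val_zpow_eq_zpow_val]
    rw [show a - 1 + c = a + c - 1 by ring, show a + (c - 1) = a + c - 1 by ring, ← add_smul]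
    congr 1
    simp only [q, Units.val_mk0, zpow_neg, zpow_add₀ h0, zpow_sub₀ h0, mul_sub, zpow_one, mul_one]
    push_cast
    field_simp
  exact LinearMap.congr_fun (LinearMap.congr_fun h a) b

theorem partialV_mul (a b : Torus θ) :
    partialV (a * b) = partialV a * twistV b + a * partialV b := by
  have h : (LinearMap.mul ℂ (Torus θ)).compr₂ partialV =
      (LinearMap.mul ℂ (Torus θ)).compl₁₂ partialV twistV.toLinearMap +
        (LinearMap.mul ℂ (Torus θ)).compl₂ partialV := by
    refine Torus.lin_ext fun a b => Torus.lin_ext fun c e => ?_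
    have h0 := phase_ne_zero θ
    simp only [LinearMap.compr₂_apply, LinearMap.mul_apply', LinearMap.add_apply,
      LinearMap.compl₁₂_apply, AlgHom.toLinearMap_apply, LinearMap.compl₂_apply,
      LinearMap.smul_apply, Torus.mono_mul_mono, map_smul, partialV_mono,
      twistV, Torus.scale_mono, smul_mul_smul_comm, smul_smul,
      mul_smul_comm, one_zpow, mul_one, Units.val_zpow_eq_zpow_val]
    rw [show b - 1 + e = b + e - 1 by ring, show b + (e - 1) = b + e - 1 by ring, ← add_smul]
    congr 1
    simp only [q, Units.val_mk0, sub_mul, zpow_sub₀ h0, one_mul]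
    push_cast
    field_simp
  exact LinearMap.congr_fun (LinearMap.congr_fun h a) b

theorem partialV_twistU (a : Torus θ) : phase θ • partialV (twistU a) = twistU (partialV a) := by
  have h : phase θ • partialV ∘ₗ twistU.toLinearMap = twistU.toLinearMap ∘ₗ partialV (θ := θ) := by
    refine Torus.lin_ext fun m n => ?_
    have h0 := phase_ne_zero θ
    simp only [LinearMap.smul_apply, LinearMap.comp_apply, AlgHom.toLinearMap_apply, twistU,
      Torus.scale_mono, map_smul, partialV_mono, smul_smul, one_zpow, one_mul, inv_zpow',
      Units.val_zpow_eq_zpow_val]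
    congr 1
    simp only [q, Units.val_mk0, neg_sub, zpow_sub₀ h0, zpow_neg, zpow_one]
    field_simp
  exact LinearMap.congr_fun h a

theorem partialU_twistV (a : Torus θ) : partialU (twistV a) = phase θ • twistV (partialU a) := by
  have h : partialU ∘ₗ twistV.toLinearMap =
      phase θ • (twistV.toLinearMap ∘ₗ partialU (θ := θ)) := by
    refine Torus.lin_ext fun m n => ?_
    have h0 := phase_ne_zero θ
    simp only [LinearMap.smul_apply, LinearMap.comp_apply, AlgHom.toLinearMap_apply, twistV,
      Torus.scale_mono, map_smul, partialU_mono, smul_smul, one_zpow, mul_one,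
      Units.val_zpow_eq_zpow_val]
    congr 1
    simp only [q, Units.val_mk0, zpow_sub₀ h0, zpow_one]
    field_simp
  exact LinearMap.congr_fun h a

theorem partialU_partialV (a : Torus θ) :
    partialU (partialV a) = phase θ • partialV (partialU a) := by
  have h : partialU ∘ₗ partialV = phase θ • (partialV ∘ₗ partialU (θ := θ)) := by
    refine Torus.lin_ext fun m n => ?_
    have h0 := phase_ne_zero θ
    simp only [LinearMap.smul_apply, LinearMap.comp_apply, map_smul, partialU_mono, partialV_mono,
      smul_smul]
    congr 1
    simp only [neg_sub, zpow_sub₀ h0, zpow_neg, zpow_one]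
    field_simp
  exact LinearMap.congr_fun h a

/-- The grading: functions, `Ω¹ = span {du, dv}`, `Ω² = span {du ∧ dv}`,
and `0` in all degrees greater than `2`. -/
def grade (θ : ℝ) : ℕ → Submodule ℂ (TorusForms θ)
  | 0 => { carrier := {ω | ω.cu = 0 ∧ ω.cv = 0 ∧ ω.cuv = 0}
           zero_mem' := by simp
           add_mem' := by rintro x y ⟨h1, h2, h3⟩ ⟨k1, k2, k3⟩; simp [*]
           smul_mem' := by rintro r x ⟨h1, h2, h3⟩; simp [*] }
  | 1 => { carrier := {ω | ω.c = 0 ∧ ω.cuv = 0}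
           zero_mem' := by simp
           add_mem' := by rintro x y ⟨h1, h2⟩ ⟨k1, k2⟩; simp [*]
           smul_mem' := by rintro r x ⟨h1, h2⟩; simp [*] }
  | 2 => { carrier := {ω | ω.c = 0 ∧ ω.cu = 0 ∧ ω.cv = 0}
           zero_mem' := by simp
           add_mem' := by rintro x y ⟨h1, h2, h3⟩ ⟨k1, k2, k3⟩; simp [*]
           smul_mem' := by rintro r x ⟨h1, h2, h3⟩; simp [*] }
  | _ + 3 => ⊥

theorem mem_grade_zero {ω : TorusForms θ} :
    ω ∈ grade θ 0 ↔ ω.cu = 0 ∧ ω.cv = 0 ∧ ω.cuv = 0 := Iff.rfl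
theorem mem_grade_one {ω : TorusForms θ} : ω ∈ grade θ 1 ↔ ω.c = 0 ∧ ω.cuv = 0 := Iff.rfl
theorem mem_grade_two {ω : TorusForms θ} :
    ω ∈ grade θ 2 ↔ ω.c = 0 ∧ ω.cu = 0 ∧ ω.cv = 0 := Iff.rfl
theorem mem_grade_add_three {n : ℕ} {ω : TorusForms θ} : ω ∈ grade θ (n + 3) ↔ ω = 0 := Iff.rfl

/-- The part of degree `0` of a form. -/
def part0 : TorusForms θ →ₗ[ℂ] grade θ 0 where
  toFun ω := ⟨⟨ω.c, 0, 0, 0⟩, rfl, rfl, rfl⟩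
  map_add' x y := by apply Subtype.ext; ext1 <;> simp
  map_smul' r x := by apply Subtype.ext; ext1 <;> simp

/-- The part of degree `1` of a form. -/
def part1 : TorusForms θ →ₗ[ℂ] grade θ 1 where
  toFun ω := ⟨⟨0, ω.cu, ω.cv, 0⟩, rfl, rfl⟩
  map_add' x y := by apply Subtype.ext; ext1 <;> simp
  map_smul' r x := by apply Subtype.ext; ext1 <;> simp

/-- The part of degree `2` of a form. -/
def part2 : TorusForms θ →ₗ[ℂ] grade θ 2 where
  toFun ω := ⟨⟨0, 0, 0, ω.cuv⟩, rfl, rfl, rfl⟩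
  map_add' x y := by apply Subtype.ext; ext1 <;> simp
  map_smul' r x := by apply Subtype.ext; ext1 <;> simp

instance : SetLike.GradedMonoid (grade θ) where
  one_mem := ⟨rfl, rfl, rfl⟩
  mul_mem := by
    rintro (_ | _ | _ | i) (_ | _ | _ | j) x y hx hy <;>
      simp only [zero_add, mem_grade_zero, mem_grade_one, mem_grade_two,
        mem_grade_add_three, Nat.reduceAdd] at hx hy <;>
      first
        | (change _ ∧ _; simp [hx, hy])
        | (change _ = (0 : TorusForms θ); ext1 <;> simp [hx, hy])

instance : DirectSum.Decomposition (grade θ) :=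
  DirectSum.Decomposition.ofLinearMap (grade θ)
    (DirectSum.lof ℂ ℕ (fun i => grade θ i) 0 ∘ₗ part0
      + DirectSum.lof ℂ ℕ (fun i => grade θ i) 1 ∘ₗ part1
      + DirectSum.lof ℂ ℕ (fun i => grade θ i) 2 ∘ₗ part2)
    (by
      ext1 ω
      simp only [LinearMap.comp_apply, LinearMap.add_apply, map_add, DirectSum.coeLinearMap_lof]
      ext1 <;> simp [part0, part1, part2])
    (by
      refine DirectSum.linearMap_ext _ fun i => ?_
      ext1 ⟨ω, hω⟩
      simp only [LinearMap.comp_apply, LinearMap.add_apply, DirectSum.coeLinearMap_lof,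
        LinearMap.id_apply]
      rcases i with _ | _ | _ | i
      · obtain ⟨h1, h2, h3⟩ := mem_grade_zero.1 hω
        have e0 : part0 ω = ⟨ω, hω⟩ := by apply Subtype.ext; ext1 <;> simp [part0, *]
        have e1 : part1 ω = 0 := by apply Subtype.ext; ext1 <;> simp [part1, *]
        have e2 : part2 ω = 0 := by apply Subtype.ext; ext1 <;> simp [part2, *]
        simp [e0, e1, e2]
      · obtain ⟨h1, h2⟩ := mem_grade_one.1 hω
        have e0 : part0 ω = 0 := by apply Subtype.ext; ext1 <;> simp [part0, *]
        have e1 : part1 ω = ⟨ω, hω⟩ := by apply Subtype.ext; ext1 <;> simp [part1, *]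
        have e2 : part2 ω = 0 := by apply Subtype.ext; ext1 <;> simp [part2, *]
        simp [e0, e1, e2]
      · obtain ⟨h1, h2, h3⟩ := mem_grade_two.1 hω
        have e0 : part0 ω = 0 := by apply Subtype.ext; ext1 <;> simp [part0, *]
        have e1 : part1 ω = 0 := by apply Subtype.ext; ext1 <;> simp [part1, *]
        have e2 : part2 ω = ⟨ω, hω⟩ := by apply Subtype.ext; ext1 <;> simp [part2, *]
        simp [e0, e1, e2]
      · obtain rfl : ω = 0 := mem_grade_add_three.1 hω
        have e : (⟨0, hω⟩ : grade θ (i + 1 + 1 + 1)) = 0 := rfl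
        simp [e])

instance : GradedAlgebra (grade θ) where

/-- The identification of the torus algebra with the forms of degree `0`. -/
def zeroEquiv : Torus θ ≃ₐ[ℂ] grade θ 0 :=
  AlgEquiv.ofBijective
    (AlgHom.codRestrict ofTorus (SetLike.GradeZero.subalgebra (grade θ)) fun a => ⟨rfl, rfl, rfl⟩)
    ⟨fun a b h => congrArg (fun x : grade θ 0 => x.1.c) h, by
      rintro ⟨ω, hω⟩
      obtain ⟨h1, h2, h3⟩ := mem_grade_zero.1 hω
      refine ⟨ω.c, Subtype.ext ?_⟩
      change ofTorus ω.c = ω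
      ext1 <;> simp [*]⟩

theorem coe_zeroEquiv (a : Torus θ) : (zeroEquiv a : TorusForms θ) = ofTorus a := rfl

end TorusForms
end NCTorus

namespace NCTorus

namespace TorusForms

variable {θ : ℝ}

theorem d_u : d (ofTorus ((Torus.u : (Torus θ)ˣ) : Torus θ)) = ⟨0, 1, 0, 0⟩ := by
  ext1 <;> simp [Torus.u, Torus.one_eq]

theorem d_v : d (ofTorus ((Torus.v : (Torus θ)ˣ) : Torus θ)) = ⟨0, 0, 1, 0⟩ := by
  ext1 <;> simp [Torus.v, Torus.one_eq]

theorem d_mem : ∀ n, ∀ ω ∈ grade θ n, d ω ∈ grade θ (n + 1) := by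
  rintro (_ | _ | _ | n) ω hω <;>
    simp only [zero_add, mem_grade_zero, mem_grade_one, mem_grade_two,
      mem_grade_add_three, Nat.reduceAdd] at hω
  · exact ⟨rfl, by simp [hω]⟩
  · exact ⟨rfl, by simp [hω], by simp [hω]⟩
  · change _ = (0 : TorusForms θ); ext1 <;> simp [hω]
  · change _ = (0 : TorusForms θ); simp [hω]

theorem d_d (ω : TorusForms θ) : d (d ω) = 0 := by
  ext1 <;> simp [partialU_partialV]

theorem leibniz : ∀ n, ∀ ω ∈ grade θ n, ∀ η,
    d (ω * η) = d ω * η + (-1 : ℂ) ^ n • (ω * d η) := by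
  rintro (_ | _ | _ | n) ω hω η <;>
    simp only [zero_add, mem_grade_zero, mem_grade_one, mem_grade_two,
      mem_grade_add_three, Nat.reduceAdd] at hω
  · ext1 <;> simp [hω, partialU_mul, partialV_mul, mul_sub]
    abel
  · ext1 <;> simp [hω, partialU_mul, partialV_mul, ← partialV_twistU,
      partialU_twistV, ← twist_comm, sub_eq_add_neg, add_mul]
    abel
  · ext1 <;> simp [hω]
  · simp [hω]

theorem generated : ∀ n, grade θ n = Submodule.span ℂ {ω | ∃ (a₀ : Torus θ) (a : Fin n → Torus θ),
    ω = (zeroEquiv a₀ : TorusForms θ) *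
      (List.ofFn fun i => d (zeroEquiv (a i) : TorusForms θ)).prod} := by
  intro n
  apply le_antisymm
  · intro ω hω
    rcases n with _ | _ | _ | n
    · obtain ⟨h1, h2, h3⟩ := mem_grade_zero.1 hω
      refine Submodule.subset_span ⟨ω.c, Fin.elim0, ?_⟩
      simp only [coe_zeroEquiv]
      ext1 <;> simp [*]
    · obtain ⟨h1, h2⟩ := mem_grade_one.1 hω
      have e : ω = ofTorus ω.cu * d (ofTorus ((Torus.u : (Torus θ)ˣ) : Torus θ)) +
          ofTorus ω.cv * d (ofTorus ((Torus.v : (Torus θ)ˣ) : Torus θ)) := by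
        rw [d_u, d_v]; ext1 <;> simp [*]
      rw [e]
      refine Submodule.add_mem _
        (Submodule.subset_span ⟨ω.cu, fun _ => (Torus.u : (Torus θ)ˣ), ?_⟩)
        (Submodule.subset_span ⟨ω.cv, fun _ => (Torus.v : (Torus θ)ˣ), ?_⟩) <;>
      simp [coe_zeroEquiv]
    · obtain ⟨h1, h2, h3⟩ := mem_grade_two.1 hω
      refine Submodule.subset_span
        ⟨ω.cuv, ![(Torus.u : (Torus θ)ˣ), (Torus.v : (Torus θ)ˣ)], ?_⟩
      simp only [coe_zeroEquiv, List.ofFn_succ, List.ofFn_zero, Matrix.cons_val_zero,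
        Matrix.cons_val_succ, d_u, d_v, List.prod_cons, List.prod_nil, mul_one]
      ext1 <;> simp [*]
    · rw [mem_grade_add_three.1 hω]; exact Submodule.zero_mem _
  · refine Submodule.span_le.2 ?_
    rintro ω ⟨a₀, a, rfl⟩
    have key : ∀ l : List (Torus θ),
        (l.map fun b => d (ofTorus b)).prod ∈ grade θ l.length := by
      intro l
      induction l with
      | nil => exact SetLike.GradedOne.one_mem
      | cons b l ih =>
        rw [List.map_cons, List.prod_cons, List.length_cons, add_comm]
        exact SetLike.GradedMul.mul_mem (d_mem 0 _ (zeroEquiv b).2) ih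
    have h := SetLike.GradedMul.mul_mem (zeroEquiv a₀).2 (key (List.ofFn a))
    rw [List.map_ofFn, List.length_ofFn, zero_add] at h
    exact h

end TorusForms

/-- The calculus `Ω(A) = A ⊕ Ω¹(A) ⊕ Ω²(A)` on the noncommutative torus. -/
def torusCalculus (θ : ℝ) : DifferentialCalculus ℂ (Torus θ) (TorusForms θ) where
  grade := TorusForms.grade θ
  d := TorusForms.d
  d_mem := TorusForms.d_mem
  d_d := TorusForms.d_d
  leibniz := TorusForms.leibniz
  zeroEquiv := TorusForms.zeroEquiv
  generated := TorusForms.generated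

/-- The coaction `u ↦ u ⊗ t`, `v ↦ v ⊗ t⁻¹` of `O(U(1)) = ℂ[t, t⁻¹]` on the torus algebra. -/
def torusCoaction (θ : ℝ) : Torus θ →ₐ[ℂ] Torus θ ⊗[ℂ] ℂ[T;T⁻¹] :=
  Torus.homOfMono (fun m n => Torus.mono m n ⊗ₜ LaurentPolynomial.T (m - n))
    (by simp [Torus.one_eq, Algebra.TensorProduct.one_def]) (by
      intro a b c d
      rw [Algebra.TensorProduct.tmul_mul_tmul, Torus.mono_mul_mono, ← LaurentPolynomial.T_add,
        TensorProduct.smul_tmul', show a + c - (b + d) = a - b + (c - d) by ring])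

/-- The relations of the calculus on the torus, in terms of the generators `u`, `v` and
the forms `du`, `dv`. -/
theorem torus_relations (θ : ℝ) (u v du dv : TorusForms θ)
    (hu : u = TorusForms.ofTorus ((Torus.u : (Torus θ)ˣ) : Torus θ))
    (hv : v = TorusForms.ofTorus ((Torus.v : (Torus θ)ˣ) : Torus θ))
    (hdu : du = (torusCalculus θ).d u) (hdv : dv = (torusCalculus θ).d v) :
    du * u = u * du ∧ dv * v = v * dv ∧
    du * v = Complex.exp (-(Complex.I * θ)) • (v * du) ∧
    dv * u = Complex.exp (Complex.I * θ) • (u * dv) ∧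
    du * dv + Complex.exp (-(Complex.I * θ)) • (dv * du) = 0 ∧
    du * du = 0 ∧ dv * dv = 0 := by
  have e1 : du = ⟨0, 1, 0, 0⟩ := by rw [hdu, hu]; exact TorusForms.d_u
  have e2 : dv = ⟨0, 0, 1, 0⟩ := by rw [hdv, hv]; exact TorusForms.d_v
  subst e1 e2 hu hv
  refine ⟨?_, ?_, ?_, ?_, ?_, ?_, ?_⟩ <;> ext1 <;>
    simp [Torus.u, Torus.v, TorusForms.twistU, TorusForms.twistV, TorusForms.q, phase,
      Complex.exp_neg, smul_smul]

theorem torusCoaction_u (θ : ℝ) : torusCoaction θ ((Torus.u : (Torus θ)ˣ) : Torus θ) =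
    ((Torus.u : (Torus θ)ˣ) : Torus θ) ⊗ₜ LaurentPolynomial.T 1 := by
  simp [torusCoaction, Torus.u]

theorem torusCoaction_v (θ : ℝ) : torusCoaction θ ((Torus.v : (Torus θ)ˣ) : Torus θ) =
    ((Torus.v : (Torus θ)ˣ) : Torus θ) ⊗ₜ LaurentPolynomial.T (-1) := by
  simp [torusCoaction, Torus.v]

/-! ## The classical calculus on `O(U(1))` -/

/-- Forms `f + g dt` on `O(U(1)) = ℂ[t, t⁻¹]`, with `dt t = t dt` and `dt ∧ dt = 0`;
`f` is the first component and `g` the second one. -/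
abbrev CircleForms : Type := TrivSqZeroExt ℂ[T;T⁻¹] ℂ[T;T⁻¹]

namespace CircleForms

open TrivSqZeroExt

/-- The derivative `tⁿ ↦ n tⁿ⁻¹`. -/
def deriv : ℂ[T;T⁻¹] →ₗ[ℂ] ℂ[T;T⁻¹] :=
  (AddMonoidAlgebra.basis ℤ ℂ).constr ℂ fun n => (n : ℂ) • LaurentPolynomial.T (n - 1)

theorem lin_ext {M : Type*} [AddCommGroup M] [Module ℂ M] {f g : ℂ[T;T⁻¹] →ₗ[ℂ] M}
    (h : ∀ n, f (LaurentPolynomial.T n) = g (LaurentPolynomial.T n)) : f = g :=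
  (AddMonoidAlgebra.basis ℤ ℂ).ext fun n => by
    rw [AddMonoidAlgebra.basis_apply]; exact h n

@[simp] theorem deriv_T (n : ℤ) : deriv (LaurentPolynomial.T n) =
    (n : ℂ) • LaurentPolynomial.T (n - 1) := by
  have h := (AddMonoidAlgebra.basis ℤ ℂ).constr_basis ℂ
    (fun n : ℤ => (n : ℂ) • (LaurentPolynomial.T (n - 1) : ℂ[T;T⁻¹])) n
  rw [AddMonoidAlgebra.basis_apply] at h
  exact h

theorem deriv_mul (f g : ℂ[T;T⁻¹]) : deriv (f * g) = deriv f * g + f * deriv g := by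
  have h : (LinearMap.mul ℂ ℂ[T;T⁻¹]).compr₂ deriv =
      (LinearMap.mul ℂ ℂ[T;T⁻¹]).compl₁₂ deriv LinearMap.id +
        (LinearMap.mul ℂ ℂ[T;T⁻¹]).compl₂ deriv := by
    refine lin_ext fun m => lin_ext fun n => ?_
    simp only [LinearMap.compr₂_apply, LinearMap.mul_apply', LinearMap.add_apply,
      LinearMap.compl₁₂_apply, LinearMap.compl₂_apply, deriv_T, LinearMap.id_apply,
      ← LaurentPolynomial.T_add, smul_mul_assoc, mul_smul_comm]
    rw [show m - 1 + n = m + n - 1 by ring, show m + (n - 1) = m + n - 1 by ring, ← add_smul]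
    push_cast
    rfl
  exact LinearMap.congr_fun (LinearMap.congr_fun h f) g

/-- The differential `d(f + g dt) = f' dt`. -/
def d : CircleForms →ₗ[ℂ] CircleForms :=
  (inrHom ℂ[T;T⁻¹] ℂ[T;T⁻¹]).restrictScalars ℂ ∘ₗ deriv ∘ₗ
    (fstHom ℂ ℂ[T;T⁻¹] ℂ[T;T⁻¹]).toLinearMap

@[simp] theorem d_apply (ω : CircleForms) : d ω = inr (deriv ω.fst) := rfl

/-- The grading: functions, `Ω¹ = span {dt}`, and `0` in all degrees greater than `1`. -/
def grade : ℕ → Submodule ℂ CircleForms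
  | 0 => { carrier := {ω | ω.snd = 0}
           zero_mem' := by simp
           add_mem' := by intro x y h k; simp_all
           smul_mem' := by intro r x h; simp_all }
  | 1 => { carrier := {ω | ω.fst = 0}
           zero_mem' := by simp
           add_mem' := by intro x y h k; simp_all
           smul_mem' := by intro r x h; simp_all }
  | _ + 2 => ⊥

theorem mem_grade_zero {ω : CircleForms} : ω ∈ grade 0 ↔ ω.snd = 0 := Iff.rfl
theorem mem_grade_one {ω : CircleForms} : ω ∈ grade 1 ↔ ω.fst = 0 := Iff.rfl
theorem mem_grade_add_two {n : ℕ} {ω : CircleForms} : ω ∈ grade (n + 2) ↔ ω = 0 := Iff.rfl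

/-- The part of degree `0` of a form. -/
def part0 : CircleForms →ₗ[ℂ] grade 0 where
  toFun ω := ⟨inl ω.fst, snd_inl _ _⟩
  map_add' x y := by apply Subtype.ext; simp
  map_smul' r x := by apply Subtype.ext; simp

/-- The part of degree `1` of a form. -/
def part1 : CircleForms →ₗ[ℂ] grade 1 where
  toFun ω := ⟨inr ω.snd, fst_inr _ _⟩
  map_add' x y := by apply Subtype.ext; simp [add_smul]
  map_smul' r x := by apply Subtype.ext; simp

instance : SetLike.GradedMonoid grade where
  one_mem := snd_one
  mul_mem := by
    rintro (_ | _ | i) (_ | _ | j) x y hx hy <;>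
      simp only [zero_add, mem_grade_zero, mem_grade_one, mem_grade_add_two] at hx hy <;>
      first
        | (change TrivSqZeroExt.snd _ = 0; simp [hx, hy])
        | (change TrivSqZeroExt.fst _ = 0; simp [hx, hy])
        | (change _ = (0 : CircleForms); ext <;> simp [hx, hy])

instance : DirectSum.Decomposition grade :=
  DirectSum.Decomposition.ofLinearMap grade
    (DirectSum.lof ℂ ℕ (fun i => grade i) 0 ∘ₗ part0
      + DirectSum.lof ℂ ℕ (fun i => grade i) 1 ∘ₗ part1)
    (by
      apply LinearMap.ext
      intro ω
      simp only [LinearMap.comp_apply, LinearMap.add_apply, map_add, DirectSum.coeLinearMap_lof]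
      exact inl_fst_add_inr_snd_eq ω)
    (by
      refine DirectSum.linearMap_ext _ fun i => ?_
      apply LinearMap.ext
      rintro ⟨ω, hω⟩
      simp only [LinearMap.comp_apply, LinearMap.add_apply, DirectSum.coeLinearMap_lof,
        LinearMap.id_apply]
      rcases i with _ | _ | i
      · have h := mem_grade_zero.1 hω
        have e0 : part0 ω = ⟨ω, hω⟩ := by apply Subtype.ext; ext <;> simp [part0, *]
        have e1 : part1 ω = 0 := by apply Subtype.ext; ext <;> simp [part1, *]
        simp [e0, e1]
      · have h := mem_grade_one.1 hω
        have e0 : part0 ω = 0 := by apply Subtype.ext; ext <;> simp [part0, *]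
        have e1 : part1 ω = ⟨ω, hω⟩ := by apply Subtype.ext; ext <;> simp [part1, *]
        simp [e0, e1]
      · obtain rfl : ω = 0 := mem_grade_add_two.1 hω
        have e : (⟨0, hω⟩ : grade (i + 1 + 1)) = 0 := rfl
        simp [e])

instance : GradedAlgebra grade where

/-- The identification of functions with the forms of degree `0`. -/
def zeroEquiv : ℂ[T;T⁻¹] ≃ₐ[ℂ] grade 0 :=
  AlgEquiv.ofBijective
    (AlgHom.codRestrict (inlAlgHom ℂ ℂ[T;T⁻¹] ℂ[T;T⁻¹]) (SetLike.GradeZero.subalgebra grade)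
      fun a => snd_inl _ a)
    ⟨fun a b h => congrArg (fun x : grade 0 => x.1.fst) h, by
      rintro ⟨ω, hω⟩
      have h := mem_grade_zero.1 hω
      refine ⟨ω.fst, Subtype.ext ?_⟩
      change inl ω.fst = ω
      ext <;> simp [*]⟩

theorem coe_zeroEquiv (a : ℂ[T;T⁻¹]) : (zeroEquiv a : CircleForms) = inl a := rfl

theorem d_mem : ∀ n, ∀ ω ∈ grade n, d ω ∈ grade (n + 1) := by
  rintro (_ | _ | n) ω hω <;>
    simp only [zero_add, mem_grade_zero, mem_grade_one, mem_grade_add_two] at hω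
  · exact fst_inr _ _
  · change d ω = 0; simp [hω]
  · change d ω = 0; simp [hω]

theorem leibniz : ∀ n, ∀ ω ∈ grade n, ∀ η,
    d (ω * η) = d ω * η + (-1 : ℂ) ^ n • (ω * d η) := by
  rintro (_ | _ | n) ω hω η <;>
    simp only [zero_add, mem_grade_zero, mem_grade_one, mem_grade_add_two] at hω
  · ext1 <;> simp [hω, deriv_mul]
    ring
  · ext1 <;> simp [hω]
  · simp [hω]

theorem generated : ∀ n, grade n = Submodule.span ℂ {ω | ∃ (a₀ : ℂ[T;T⁻¹]) (a : Fin n → ℂ[T;T⁻¹]),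
    ω = (zeroEquiv a₀ : CircleForms) *
      (List.ofFn fun i => d (zeroEquiv (a i) : CircleForms)).prod} := by
  intro n
  apply le_antisymm
  · intro ω hω
    rcases n with _ | _ | n
    · have h := mem_grade_zero.1 hω
      refine Submodule.subset_span ⟨ω.fst, Fin.elim0, ?_⟩
      simp only [coe_zeroEquiv]
      ext1 <;> simp [*]
    · have h := mem_grade_one.1 hω
      refine Submodule.subset_span ⟨ω.snd, fun _ => LaurentPolynomial.T 1, ?_⟩
      simp only [coe_zeroEquiv]
      ext1 <;> simp [*]
    · rw [mem_grade_add_two.1 hω]; exact Submodule.zero_mem _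
  · refine Submodule.span_le.2 ?_
    rintro ω ⟨a₀, a, rfl⟩
    have key : ∀ l : List ℂ[T;T⁻¹],
        (l.map fun b => d (zeroEquiv b)).prod ∈ grade l.length := by
      intro l
      induction l with
      | nil => exact SetLike.GradedOne.one_mem
      | cons b l ih =>
        rw [List.map_cons, List.prod_cons, List.length_cons, add_comm]
        exact SetLike.GradedMul.mul_mem (d_mem 0 _ (zeroEquiv b).2) ih
    have h := SetLike.GradedMul.mul_mem (zeroEquiv a₀).2 (key (List.ofFn a))
    rw [List.map_ofFn, List.length_ofFn, zero_add] at h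
    exact h

end CircleForms

/-- The classical calculus `Ω(H) = H ⊕ Ω¹(H)` on `H = O(U(1)) = ℂ[t, t⁻¹]`. -/
def circleCalculus : DifferentialCalculus ℂ ℂ[T;T⁻¹] CircleForms where
  grade := CircleForms.grade
  d := CircleForms.d
  d_mem := CircleForms.d_mem
  d_d := fun ω => by simp
  leibniz := CircleForms.leibniz
  zeroEquiv := CircleForms.zeroEquiv
  generated := CircleForms.generated

end NCTorus

end

open NCTorus NCTorus.DifferentialCalculus

/-!
Everything is determined by the images of `du` and `dv` under an extended coaction, which have to be
`U = du ⊗ t + u ⊗ dt` and `V = dv ⊗ t⁻¹ - v ⊗ t⁻² dt`. The forms on the torus are the algebra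
generated by functions and `du`, `dv` subject to the commutation relations (`torusLift`), and `U`,
`V` satisfy these relations in the graded tensor product; this gives the extension `formCoaction`.
It commutes with the differentials since it does so on functions (`tensorD_coactionHom`) and `U`, `V`
and `U V` are closed. It is the only extension (`eq_formCoaction`).

The remaining claims are read off from its components (`component_formCoaction`). The part of the
coaction of `a + f du + g dv + h du ∧ dv` which involves `dt` vanishes if and only if `h = 0` and
`f u = g v` (`mem_horizontalForms_iff`). Such a form equals `a + b d(uv)` with `b = exp (i θ) f v⁻¹`
(`eq_add_mul_d_uv`). Since `uv` is coinvariant, `d(uv)` is a base form, so the horizontal forms are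
`A Ω(B) A`. A base form is in addition coinvariant, which forces `a` and `b` to lie in `B`
(`exists_eq_of_mem_baseForms`); hence the base forms are `B ⊕ B d(uv)`, which is the
pullback calculus.

On the circle the left coaction is `tⁿ ↦ tⁿ ⊗ tⁿ`, `tⁿ dt ↦ tⁿ⁺¹ ⊗ tⁿ dt`, so that the coinvariant
forms are spanned by `1` and `t⁻¹ dt`. The adjoint coaction is trivial (`adjoint_eq`), and
`u⁻¹ du ↦ u⁻¹ du ⊗ 1 + 1 ⊗ t⁻¹ dt` (`formCoaction_logForm`) says that `t⁻¹ dt ↦ u⁻¹ du` is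
colinear and splits the projection to vertical forms.
-/

noncomputable section

namespace NCTorus

/-! ### Tensor products of calculi -/

namespace DifferentialCalculus

variable {K A H Ω Ω' : Type*} [Field K] [Ring A] [Algebra K A] [Ring H] [Algebra K H]
  [Ring Ω] [Algebra K Ω] [Ring Ω'] [Algebra K Ω']

theorem incl_mem (C : DifferentialCalculus K A Ω) (a : A) : C.incl a ∈ C.grade 0 :=
  (C.zeroEquiv a).2

theorem decomposeLinearEquiv_of_mem (C : DifferentialCalculus K A Ω) {n : ℕ} {ω : Ω}
    (h : ω ∈ C.grade n) : DirectSum.decomposeLinearEquiv C.grade ω =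
      DirectSum.lof K ℕ (fun i => C.grade i) n ⟨ω, h⟩ :=
  DirectSum.decompose_of_mem C.grade h

theorem signMap_of_mem (C : DifferentialCalculus K A Ω) {n : ℕ} {ω : Ω} (h : ω ∈ C.grade n) :
    C.signMap ω = (-1 : K) ^ n • ω := by
  simp only [signMap, LinearMap.comp_apply, LinearEquiv.coe_coe, C.decomposeLinearEquiv_of_mem h,
    DirectSum.toModule_lof]
  rfl

theorem proj0_incl (C : DifferentialCalculus K A Ω) (a : A) : C.proj0 (C.incl a) = a := by
  simp only [proj0, LinearMap.comp_apply, LinearEquiv.coe_coe,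
    C.decomposeLinearEquiv_of_mem (C.incl_mem a), DirectSum.component.lof_self]
  exact C.zeroEquiv.symm_apply_apply a

theorem proj0_of_mem (C : DifferentialCalculus K A Ω) {n : ℕ} {ω : Ω} (hn : n ≠ 0)
    (h : ω ∈ C.grade n) : C.proj0 ω = 0 := by
  simp only [proj0, LinearMap.comp_apply, LinearEquiv.coe_coe, C.decomposeLinearEquiv_of_mem h,
    DirectSum.component.of, dif_neg hn, map_zero]

theorem decompose_mem (C : DifferentialCalculus K A Ω) (S : Submodule K Ω) {i : ℕ} {x : Ω}
    (hx : x ∈ C.grade i) (hS : x ∈ S) (n : ℕ) : (DirectSum.decompose C.grade x n : Ω) ∈ S := by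
  by_cases hn : i = n
  · subst hn
    rwa [DirectSum.decompose_of_mem_same _ hx]
  · rw [DirectSum.decompose_of_mem_ne _ hx hn]
    exact zero_mem _

variable {C : DifferentialCalculus K A Ω} {D : DifferentialCalculus K H Ω'}

variable (C D) in
/-- The element `x ⊗ y` of the tensor product of two calculi. -/
def tprod (x : Ω) (y : Ω') : C.Tensor D := GradedTensorProduct.of K C.grade D.grade (x ⊗ₜ y)

/-- Induction on the tensor product of two calculi, with a homogeneous first tensor factor, as the
signs of the product and of the differential depend on its degree. -/
theorem tensor_induction {p : C.Tensor D → Prop} (w : C.Tensor D) (h0 : p 0)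
    (ht : ∀ i, ∀ x ∈ C.grade i, ∀ y, p (C.tprod D x y)) (ha : ∀ a b, p a → p b → p (a + b)) :
    p w := by
  have key : ∀ z : Ω ⊗[K] Ω', p (GradedTensorProduct.of K C.grade D.grade z) := by
    intro z
    induction z using TensorProduct.induction_on with
    | zero => rwa [map_zero]
    | add a b iha ihb => rw [map_add]; exact ha _ _ iha ihb
    | tmul x y =>
      induction x using DirectSum.Decomposition.inductionOn C.grade with
      | zero => rwa [TensorProduct.zero_tmul, map_zero]
      | homogeneous x => exact ht _ _ x.2 y
      | add a b iha ihb => rw [TensorProduct.add_tmul, map_add]; exact ha _ _ iha ihb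
  exact key w

/-- The Koszul sign rule, with the sign as a scalar of the ground field. -/
theorem tprod_mul_tprod {i j : ℕ} (x : Ω) {y : Ω'} (hy : y ∈ D.grade i) {z : Ω} (hz : z ∈ C.grade j)
    (w : Ω') : C.tprod D x y * C.tprod D z w = (-1 : K) ^ (i * j) • C.tprod D (x * z) (y * w) := by
  have h := GradedTensorProduct.tmul_coe_mul_coe_tmul C.grade D.grade x ⟨y, hy⟩ ⟨z, hz⟩ w
  refine h.trans ?_
  rcases Nat.even_or_odd (i * j) with e | e
  · have e' : ((-1 : ℤˣ) ^ (i * j)) = 1 := e.neg_one_pow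
    refine (congrArg (fun c : ℤˣ => c • _) e').trans ?_
    rw [e.neg_one_pow, one_smul, one_smul]
    rfl
  · have e' : ((-1 : ℤˣ) ^ (i * j)) = -1 := e.neg_one_pow
    refine (congrArg (fun c : ℤˣ => c • _) e').trans ?_
    rw [e.neg_one_pow, neg_one_smul, Units.neg_smul, one_smul]
    rfl

theorem tensorD_tprod {n : ℕ} {ω : Ω} (h : ω ∈ C.grade n) (η : Ω') :
    C.tensorD D (C.tprod D ω η) = C.tprod D (C.d ω) η + (-1 : K) ^ n • C.tprod D ω (D.d η) := by
  rw [tprod, tensorD, LinearMap.comp_apply, LinearMap.comp_apply, LinearEquiv.coe_coe,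
    LinearEquiv.coe_coe, GradedTensorProduct.of_symm_of, LinearMap.add_apply,
    TensorProduct.map_tmul, TensorProduct.map_tmul, signMap_of_mem C h, LinearMap.id_apply,
    ← TensorProduct.smul_tmul', map_add, map_smul]
  rfl

theorem tprod_add (x : Ω) (y z : Ω') : C.tprod D x (y + z) = C.tprod D x y + C.tprod D x z := by
  rw [tprod, TensorProduct.tmul_add, map_add]; rfl
theorem add_tprod (x y : Ω) (z : Ω') : C.tprod D (x + y) z = C.tprod D x z + C.tprod D y z := by
  rw [tprod, TensorProduct.add_tmul, map_add]; rfl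
theorem tprod_smul (r : K) (x : Ω) (y : Ω') : C.tprod D x (r • y) = r • C.tprod D x y := by
  rw [tprod, TensorProduct.tmul_smul, map_smul]; rfl
theorem smul_tprod (r : K) (x : Ω) (y : Ω') : C.tprod D (r • x) y = r • C.tprod D x y := by
  rw [tprod, ← TensorProduct.smul_tmul', map_smul]; rfl
theorem tprod_zero_right (x : Ω) : C.tprod D x 0 = 0 := by
  rw [tprod, TensorProduct.tmul_zero, map_zero]
theorem tprod_zero_left (y : Ω') : C.tprod D 0 y = 0 := by
  rw [tprod, TensorProduct.zero_tmul, map_zero]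

variable (C D) in
/-- The inclusion `A ⊗ H → Ω(A) ⊗ Ω(H)` of the part of bidegree `(0, 0)`. -/
def tensorIncl : A ⊗[K] H →ₐ[K] C.Tensor D :=
  Algebra.TensorProduct.algHomOfLinearMapTensorProduct
    ((GradedTensorProduct.of K C.grade D.grade).toLinearMap ∘ₗ
      TensorProduct.map C.incl.toLinearMap D.incl.toLinearMap)
    (fun a₁ a₂ b₁ b₂ => by
      have h := tprod_mul_tprod (C.incl a₁) (D.incl_mem b₁) (C.incl_mem a₂) (D.incl b₂)
      rw [mul_zero, pow_zero, one_smul, ← map_mul, ← map_mul] at h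
      exact h.symm)
    (by
      change C.tprod D (C.incl 1) (D.incl 1) = _
      rw [map_one, map_one]
      rfl)

theorem tensorIncl_tmul (a : A) (h : H) :
    C.tensorIncl D (a ⊗ₜ h) = C.tprod D (C.incl a) (D.incl h) := rfl

theorem tensorIncl_tmul_mul_tprod (a : A) (h : H) {i : ℕ} {x : Ω} (hx : x ∈ C.grade i) (y : Ω') :
    C.tensorIncl D (a ⊗ₜ h) * C.tprod D x y = C.tprod D (C.incl a * x) (D.incl h * y) := by
  rw [tensorIncl_tmul, tprod_mul_tprod _ (D.incl_mem h) hx, zero_mul, pow_zero, one_smul]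

theorem incl_mul_mem (a : A) {n : ℕ} {x : Ω} (hx : x ∈ C.grade n) : C.incl a * x ∈ C.grade n := by
  have h := SetLike.GradedMul.mul_mem (C.incl_mem a) hx
  rwa [zero_add] at h

/-- Left multiplication by elements of bidegree `(0, 0)` preserves the tensor grading. -/
theorem tensorIncl_mul_mem (z : A ⊗[K] H) {n : ℕ} {w : C.Tensor D} (hw : w ∈ C.tensorGrade D n) :
    C.tensorIncl D z * w ∈ C.tensorGrade D n := by
  induction hw using Submodule.span_induction with
  | zero => rw [mul_zero]; exact Submodule.zero_mem _
  | add a b _ _ iha ihb => rw [mul_add]; exact Submodule.add_mem _ iha ihb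
  | smul r a _ ih => rw [mul_smul_comm]; exact Submodule.smul_mem _ r ih
  | mem w hw =>
    obtain ⟨i, j, rfl, x, hx, y, hy, rfl⟩ := hw
    induction z using TensorProduct.induction_on with
    | zero => rw [map_zero, zero_mul]; exact Submodule.zero_mem _
    | add a b iha ihb => rw [map_add, add_mul]; exact Submodule.add_mem _ iha ihb
    | tmul a h =>
      have e := tensorIncl_tmul_mul_tprod (D := D) a h hx y
      rw [tprod] at e
      rw [e]
      exact Submodule.subset_span ⟨i, j, rfl, _, incl_mul_mem a hx, _, incl_mul_mem h hy, rfl⟩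

theorem tprod_mem {i j : ℕ} {x : Ω} (hx : x ∈ C.grade i) {y : Ω'} (hy : y ∈ D.grade j) {n : ℕ}
    (h : i + j = n) : C.tprod D x y ∈ C.tensorGrade D n :=
  Submodule.subset_span ⟨i, j, h, x, hx, y, hy, rfl⟩

/-- The Leibniz rule for a left factor of degree `0`. -/
theorem tensorD_tensorIncl_mul (z : A ⊗[K] H) (w : C.Tensor D) :
    C.tensorD D (C.tensorIncl D z * w) =
      C.tensorD D (C.tensorIncl D z) * w + C.tensorIncl D z * C.tensorD D w := by
  induction z using TensorProduct.induction_on with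
  | zero => simp only [map_zero, zero_mul, zero_add]
  | add a b iha ihb =>
    simp only [map_add, add_mul, iha, ihb]
    abel
  | tmul a h =>
    induction w using tensor_induction with
    | h0 => simp only [map_zero, mul_zero, add_zero]
    | ha a b iha ihb =>
      simp only [map_add, mul_add, iha, ihb]
      abel
    | ht i x hx y =>
      have l1 := C.leibniz 0 _ (C.incl_mem a) x
      have l2 := D.leibniz 0 _ (D.incl_mem h) y
      rw [pow_zero, one_smul] at l1 l2
      rw [tensorIncl_tmul_mul_tprod a h hx, tensorD_tprod (incl_mul_mem a hx), l1, l2,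
        tensorIncl_tmul,
        tensorD_tprod (C.incl_mem a), tensorD_tprod hx, add_mul, mul_add, mul_smul_comm,
        ← tensorIncl_tmul, tensorIncl_tmul_mul_tprod a h (C.d_mem _ _ hx),
        tensorIncl_tmul_mul_tprod a h hx, tprod_mul_tprod _ (D.incl_mem h) hx, pow_zero, one_smul,
        tprod_mul_tprod _ (D.d_mem 0 _ (D.incl_mem h)) hx, zero_mul, pow_zero, one_smul, zero_add,
        one_mul, add_tprod, tprod_add, smul_add]
      abel

theorem d_one (D : DifferentialCalculus K H Ω') : D.d 1 = 0 := by
  have h := D.leibniz 0 1 (SetLike.GradedOne.one_mem) 1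
  rw [pow_zero, one_smul, mul_one, one_mul, mul_one] at h
  exact left_eq_add.1 h

/-! ### Base forms and horizontal forms of a complete calculus -/

variable {Δ : A →ₐ[K] A ⊗[K] H} {F : Ω →ₐ[K] C.Tensor D}

theorem mem_baseForms {ω : Ω} : ω ∈ baseForms F ↔ F ω = C.tprod D ω 1 := Iff.rfl

theorem mem_coinvariants {a : A} : a ∈ coinvariants Δ ↔ Δ a = a ⊗ₜ 1 := Iff.rfl

/-- `d(ω ⊗ 1) = dω ⊗ 1`, also for inhomogeneous `ω`. -/
theorem tensorD_tprod_one (ω : Ω) : C.tensorD D (C.tprod D ω 1) = C.tprod D (C.d ω) 1 := by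
  induction ω using DirectSum.Decomposition.inductionOn C.grade with
  | zero => simp only [map_zero, tprod_zero_left]
  | homogeneous x => rw [tensorD_tprod x.2, d_one, tprod_zero_right, smul_zero, add_zero]
  | add a b iha ihb => rw [add_tprod, map_add, iha, ihb, map_add, add_tprod]

theorem IsCoactionExtension.apply_incl (hF : C.IsCoactionExtension D Δ F) (a : A) :
    F (C.incl a) = C.tensorIncl D (Δ a) := hF.extend a

theorem IsCoactionExtension.d_mem_baseForms (hF : C.IsCoactionExtension D Δ F) {ω : Ω}
    (h : ω ∈ baseForms F) : C.d ω ∈ baseForms F := by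
  rw [mem_baseForms] at h ⊢
  rw [hF.map_d, h, tensorD_tprod_one]

theorem IsCoactionExtension.incl_mem_baseForms (hF : C.IsCoactionExtension D Δ F) {b : A}
    (h : b ∈ coinvariants Δ) : C.incl b ∈ baseForms F := by
  rw [mem_coinvariants] at h
  rw [mem_baseForms, hF.apply_incl, h, tensorIncl_tmul, map_one]

/-- Products of coinvariants and their differentials are base forms, because base forms are a
subalgebra closed under `d`. This inclusion holds for any complete calculus. -/
theorem IsCoactionExtension.pullbackForms_le (hF : C.IsCoactionExtension D Δ F) (n : ℕ) :
    C.pullbackForms (coinvariants Δ) n ≤ Subalgebra.toSubmodule (baseForms F) ⊓ C.grade n := by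
  refine Submodule.span_le.2 ?_
  rintro ω ⟨b₀, h₀, b, hb, rfl⟩
  constructor
  · refine (baseForms F).mul_mem (hF.incl_mem_baseForms h₀) (Subalgebra.list_prod_mem _ ?_)
    intro x hx
    obtain ⟨i, rfl⟩ := List.mem_ofFn.1 hx
    exact hF.d_mem_baseForms (hF.incl_mem_baseForms (hb i))
  · rw [C.generated n]
    exact Submodule.subset_span ⟨b₀, b, rfl⟩

variable (C D) in
/-- The component of an element of `Ω(A) ⊗ Ω(H)` along two linear maps. -/
def component (φ : Ω →ₗ[K] A) (ψ : Ω' →ₗ[K] H) : C.Tensor D →ₗ[K] A ⊗[K] H :=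
  TensorProduct.map φ ψ ∘ₗ (GradedTensorProduct.of K C.grade D.grade).symm.toLinearMap

theorem component_tprod (φ : Ω →ₗ[K] A) (ψ : Ω' →ₗ[K] H) (x : Ω) (y : Ω') :
    C.component D φ ψ (C.tprod D x y) = φ x ⊗ₜ ψ y := rfl

/-- If `φ` and `ψ` are left linear over `A` and `H`, then the component along them is left linear
over `A ⊗ H`. -/
theorem component_tensorIncl_mul {φ : Ω →ₗ[K] A} {ψ : Ω' →ₗ[K] H}
    (hφ : ∀ a x, φ (C.incl a * x) = a * φ x) (hψ : ∀ h y, ψ (D.incl h * y) = h * ψ y)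
    (z : A ⊗[K] H) (w : C.Tensor D) :
    C.component D φ ψ (C.tensorIncl D z * w) = z * C.component D φ ψ w := by
  induction z using TensorProduct.induction_on with
  | zero => simp only [map_zero, zero_mul]
  | add a b iha ihb => simp only [map_add, add_mul, iha, ihb]
  | tmul a h =>
    induction w using tensor_induction with
    | h0 => simp only [map_zero, mul_zero]
    | ha a b iha ihb => simp only [map_add, mul_add, iha, ihb]
    | ht i x hx y =>
      rw [tensorIncl_tmul_mul_tprod a h hx, component_tprod, component_tprod, hφ, hψ,
        Algebra.TensorProduct.tmul_mul_tmul]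

theorem mem_horizontalForms {ω : Ω} : ω ∈ horizontalForms F ↔ F ω ∈ LinearMap.range
    ((GradedTensorProduct.of K C.grade D.grade).toLinearMap ∘ₗ
      TensorProduct.map LinearMap.id (D.grade 0).subtype) := Iff.rfl

theorem component_eq_zero_of_horizontal {ω : Ω} (h : ω ∈ horizontalForms F) (φ : Ω →ₗ[K] A)
    {ψ : Ω' →ₗ[K] H} (hψ : ∀ y ∈ D.grade 0, ψ y = 0) : C.component D φ ψ (F ω) = 0 := by
  obtain ⟨z, hz⟩ := h
  rw [AlgHom.toLinearMap_apply] at hz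
  rw [← hz]
  clear hz
  change TensorProduct.map φ ψ (TensorProduct.map LinearMap.id (D.grade 0).subtype z) = 0
  induction z using TensorProduct.induction_on with
  | zero => simp only [map_zero]
  | add a b iha ihb => rw [map_add, map_add, iha, ihb, add_zero]
  | tmul a h => rw [TensorProduct.map_tmul, TensorProduct.map_tmul, Submodule.subtype_apply,
      hψ _ h.2, TensorProduct.tmul_zero]

/-- Elements `z (x ⊗ 1)` with `z ∈ A ⊗ H` lie in `Ω(A) ⊗ H`; this is how forms are shown to be
horizontal. -/
theorem tensorIncl_mul_tprod_one_mem (z : A ⊗[K] H) (x : Ω) :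
    C.tensorIncl D z * C.tprod D x 1 ∈ LinearMap.range
      ((GradedTensorProduct.of K C.grade D.grade).toLinearMap ∘ₗ
        TensorProduct.map LinearMap.id (D.grade 0).subtype) := by
  induction z using TensorProduct.induction_on with
  | zero => rw [map_zero, zero_mul]; exact Submodule.zero_mem _
  | add a b iha ihb => rw [map_add, add_mul]; exact Submodule.add_mem _ iha ihb
  | tmul a h =>
    induction x using DirectSum.Decomposition.inductionOn C.grade with
    | zero => rw [tprod_zero_left, mul_zero]; exact Submodule.zero_mem _
    | add a b iha ihb => rw [add_tprod, mul_add]; exact Submodule.add_mem _ iha ihb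
    | homogeneous x =>
      rw [tensorIncl_tmul_mul_tprod a h x.2, mul_one]
      exact ⟨(C.incl a * x) ⊗ₜ ⟨D.incl h, D.incl_mem h⟩, rfl⟩

end DifferentialCalculus

open TrivSqZeroExt LaurentPolynomial

/-! ### Forms on the circle and their coactions -/

theorem circle_incl (h : ℂ[T;T⁻¹]) : circleCalculus.incl h = inl h := rfl
theorem circle_d (ω : CircleForms) : circleCalculus.d ω = inr (CircleForms.deriv ω.fst) := rfl
theorem circle_inr_mem (h : ℂ[T;T⁻¹]) : (inr h : CircleForms) ∈ circleCalculus.grade 1 :=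
  fst_inr _ _
theorem circle_inl_mem (h : ℂ[T;T⁻¹]) : (inl h : CircleForms) ∈ circleCalculus.grade 0 :=
  snd_inl _ _

/-- The coefficient `f` of `f + g dt`, as a linear map. -/
def circleFst : CircleForms →ₗ[ℂ] ℂ[T;T⁻¹] := (fstHom ℂ ℂ[T;T⁻¹] ℂ[T;T⁻¹]).toLinearMap
/-- The coefficient `g` of `f + g dt`, as a linear map. -/
def circleSnd : CircleForms →ₗ[ℂ] ℂ[T;T⁻¹] :=
  (sndHom ℂ[T;T⁻¹] ℂ[T;T⁻¹]).restrictScalars ℂ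
/-- The inclusion `f ↦ f` of functions into forms, as a linear map. -/
def circleInl : ℂ[T;T⁻¹] →ₗ[ℂ] CircleForms := (inlAlgHom ℂ ℂ[T;T⁻¹] ℂ[T;T⁻¹]).toLinearMap
/-- The inclusion `g ↦ g dt` into forms, as a linear map. -/
def circleInr : ℂ[T;T⁻¹] →ₗ[ℂ] CircleForms :=
  (inrHom ℂ[T;T⁻¹] ℂ[T;T⁻¹]).restrictScalars ℂ

@[simp] theorem circleFst_apply (ω : CircleForms) : circleFst ω = ω.fst := rfl
@[simp] theorem circleSnd_apply (ω : CircleForms) : circleSnd ω = ω.snd := rfl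
@[simp] theorem circleInl_apply (h : ℂ[T;T⁻¹]) : circleInl h = inl h := rfl
@[simp] theorem circleInr_apply (h : ℂ[T;T⁻¹]) : circleInr h = inr h := rfl

/-- Linear maps on the forms of the circle agree if they agree on all `tⁿ` and `tⁿ dt`. -/
theorem circle_lin_ext {M : Type*} [AddCommGroup M] [Module ℂ M] {f g : CircleForms →ₗ[ℂ] M}
    (h0 : ∀ n, f (inl (T n)) = g (inl (T n))) (h1 : ∀ n, f (inr (T n)) = g (inr (T n))) :
    f = g := by
  have e0 : f ∘ₗ circleInl = g ∘ₗ circleInl := CircleForms.lin_ext h0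
  have e1 : f ∘ₗ circleInr = g ∘ₗ circleInr := CircleForms.lin_ext h1
  ext ω
  rw [← inl_fst_add_inr_snd_eq ω, map_add, map_add]
  exact congrArg₂ (· + ·) (LinearMap.congr_fun e0 ω.fst) (LinearMap.congr_fun e1 ω.snd)

/-- In the encoding of forms as a square-zero extension, `t⁻¹ dt` is `inr (T (-1))`. -/
theorem maurerCartan_eq :
    circleCalculus.incl (T (-1)) * circleCalculus.d (circleCalculus.incl (T 1)) = inr (T (-1)) := by
  rw [circle_incl, circle_incl, circle_d]
  ext1 <;> simp

theorem comul_T (n : ℤ) : Coalgebra.comul (R := ℂ) (T n : ℂ[T;T⁻¹]) = T n ⊗ₜ T n := by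
  have h := comul_C_mul_T_self (1 : ℂ) n
  rwa [map_one, one_mul] at h

theorem counit_T (n : ℤ) : Coalgebra.counit (R := ℂ) (T n : ℂ[T;T⁻¹]) = 1 := by
  have h := counit_C_mul_T (R := ℂ) (1 : ℂ) n
  rw [map_one, one_mul] at h
  exact h

/-! ### Left coinvariant and vertical forms -/

/-- The left coaction on the forms of the circle is determined by its axioms. -/
theorem leftCoaction_inl {L : CircleForms →ₐ[ℂ] ℂ[T;T⁻¹] ⊗[ℂ] CircleForms}
    (hL : circleCalculus.IsLeftCoaction L) (n : ℤ) : L (inl (T n)) = T n ⊗ₜ inl (T n) := by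
  have := hL.extend (T n)
  rw [circle_incl] at this
  rw [this, comul_T]
  rfl

theorem leftCoaction_inr {L : CircleForms →ₐ[ℂ] ℂ[T;T⁻¹] ⊗[ℂ] CircleForms}
    (hL : circleCalculus.IsLeftCoaction L) (n : ℤ) :
    L (inr (T n)) = T (n + 1) ⊗ₜ inr (T n) := by
  have h := hL.map_d (inl (T 1))
  rw [leftCoaction_inl hL] at h
  have e : (inr (T n) : CircleForms) = inl (T n) * circleCalculus.d (inl (T 1)) := by
    rw [circle_d]; ext1 <;> simp
  rw [e, map_mul, leftCoaction_inl hL, h]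
  rw [TensorProduct.map_tmul, Algebra.TensorProduct.tmul_mul_tmul, LinearMap.id_apply, ← T_add]

/-- The functional `f + g dt ↦ ε(f)`. -/
def circleCounitFst : CircleForms →ₗ[ℂ] ℂ := Coalgebra.counit ∘ₗ circleFst

/-- The functional `f + g dt ↦ ε(g)`. -/
def circleCounitSnd : CircleForms →ₗ[ℂ] ℂ := Coalgebra.counit ∘ₗ circleSnd

/-- The counit on the second factor recovers a function from its left coaction. -/
theorem counit_fst_leftCoaction {L : CircleForms →ₐ[ℂ] ℂ[T;T⁻¹] ⊗[ℂ] CircleForms}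
    (hL : circleCalculus.IsLeftCoaction L) (h : ℂ[T;T⁻¹]) :
    TensorProduct.rid ℂ _ (TensorProduct.map LinearMap.id circleCounitFst (L (inl h))) = h := by
  have e : (TensorProduct.rid ℂ ℂ[T;T⁻¹]).toLinearMap ∘ₗ
      TensorProduct.map LinearMap.id circleCounitFst ∘ₗ L.toLinearMap ∘ₗ circleInl =
      LinearMap.id := by
    refine CircleForms.lin_ext fun n => ?_
    simp only [LinearMap.comp_apply, LinearEquiv.coe_coe, circleInl_apply,
      AlgHom.toLinearMap_apply, leftCoaction_inl hL, TensorProduct.map_tmul, LinearMap.id_apply,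
      TensorProduct.rid_tmul, circleCounitFst, circleFst_apply, fst_inl, counit_T, one_smul]
  exact LinearMap.congr_fun e h

/-- The counit on the coefficient of `dt` in the second factor turns the left coaction of `h dt`
into `h t`. Hence a coinvariant `h dt` has `h t` constant. -/
theorem counit_snd_leftCoaction {L : CircleForms →ₐ[ℂ] ℂ[T;T⁻¹] ⊗[ℂ] CircleForms}
    (hL : circleCalculus.IsLeftCoaction L) (h : ℂ[T;T⁻¹]) :
    TensorProduct.rid ℂ _ (TensorProduct.map LinearMap.id circleCounitSnd (L (inr h))) =
      h * T 1 := by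
  have e : (TensorProduct.rid ℂ ℂ[T;T⁻¹]).toLinearMap ∘ₗ
      TensorProduct.map LinearMap.id circleCounitSnd ∘ₗ L.toLinearMap ∘ₗ circleInr =
      LinearMap.mulRight ℂ (T 1) := by
    refine CircleForms.lin_ext fun n => ?_
    simp only [LinearMap.comp_apply, LinearEquiv.coe_coe, circleInr_apply,
      AlgHom.toLinearMap_apply, leftCoaction_inr hL, TensorProduct.map_tmul, LinearMap.id_apply,
      TensorProduct.rid_tmul, circleCounitSnd, circleSnd_apply, snd_inr, counit_T, one_smul,
      LinearMap.mulRight_apply, ← T_add]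
  exact LinearMap.congr_fun e h

theorem leftCoinvariants_zero {L : CircleForms →ₐ[ℂ] ℂ[T;T⁻¹] ⊗[ℂ] CircleForms}
    (hL : circleCalculus.IsLeftCoaction L) :
    circleCalculus.leftCoinvariants L 0 = Submodule.span ℂ {1} := by
  apply le_antisymm
  · rintro ω ⟨h0, h1⟩
    have h0 : ω.snd = 0 := h0
    have h1 : L ω = 1 ⊗ₜ ω := h1
    have e : ω = inl ω.fst := by ext1 <;> simp [h0]
    have h2 := counit_fst_leftCoaction hL ω.fst
    rw [← e, h1] at h2
    simp only [TensorProduct.map_tmul, LinearMap.id_apply, TensorProduct.rid_tmul] at h2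
    refine Submodule.mem_span_singleton.2 ⟨circleCounitFst ω, ?_⟩
    rw [e, ← h2]
    ext1 <;> simp [circleCounitFst, ← T_zero]
  · rw [Submodule.span_singleton_le_iff_mem]
    exact ⟨snd_one, L.map_one'⟩

theorem leftCoinvariants_one {L : CircleForms →ₐ[ℂ] ℂ[T;T⁻¹] ⊗[ℂ] CircleForms}
    (hL : circleCalculus.IsLeftCoaction L) :
    circleCalculus.leftCoinvariants L 1 = Submodule.span ℂ {inr (T (-1))} := by
  apply le_antisymm
  · rintro ω ⟨h0, h1⟩
    have h0 : ω.fst = 0 := h0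
    have h1 : L ω = 1 ⊗ₜ ω := h1
    have e : ω = inr ω.snd := by ext1 <;> simp [h0]
    have h2 := counit_snd_leftCoaction hL ω.snd
    rw [← e, h1] at h2
    simp only [TensorProduct.map_tmul, LinearMap.id_apply, TensorProduct.rid_tmul] at h2
    refine Submodule.mem_span_singleton.2 ⟨circleCounitSnd ω, ?_⟩
    -- `h2` says that the coefficient times `t` is constant
    have h3 := congrArg (· * (T (-1) : ℂ[T;T⁻¹])) h2
    simp only [smul_mul_assoc, one_mul, mul_assoc, ← T_add, add_neg_cancel, T_zero, mul_one] at h3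
    rw [← inr_smul, h3, ← e]
  · rw [Submodule.span_singleton_le_iff_mem]
    refine ⟨fst_inr _ _, ?_⟩
    change L (inr (T (-1))) = 1 ⊗ₜ inr (T (-1))
    rw [leftCoaction_inr hL]
    simp

theorem leftCoinvariants_of_two_le (L : CircleForms →ₐ[ℂ] ℂ[T;T⁻¹] ⊗[ℂ] CircleForms) {n : ℕ}
    (hn : 2 ≤ n) : circleCalculus.leftCoinvariants L n = ⊥ := by
  obtain ⟨k, rfl⟩ := Nat.exists_eq_add_of_le' hn
  exact eq_bot_iff.2 fun ω h => h.1

/-- If `Λⁿ` is spanned by one form `η`, then every element of `A ⊗ Λⁿ` is a pure tensor `a ⊗ η`. -/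
theorem mem_verticalForms_of_span {L : CircleForms →ₐ[ℂ] ℂ[T;T⁻¹] ⊗[ℂ] CircleForms}
    {A : Type*} [Ring A] [Algebra ℂ A] {n : ℕ} {η : CircleForms}
    (h : circleCalculus.leftCoinvariants L n = Submodule.span ℂ {η}) (x : A ⊗[ℂ] CircleForms) :
    x ∈ verticalForms A circleCalculus L n ↔ ∃ a : A, x = a ⊗ₜ η := by
  constructor
  · rintro ⟨y, rfl⟩
    induction y using TensorProduct.induction_on with
    | zero => exact ⟨0, by simp⟩
    | tmul a ϑ =>
      obtain ⟨ϑ, hϑ⟩ := ϑ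
      rw [h] at hϑ
      obtain ⟨r, rfl⟩ := Submodule.mem_span_singleton.1 hϑ
      exact ⟨r • a, (TensorProduct.smul_tmul r a η).symm⟩
    | add y z hy hz =>
      obtain ⟨a, ha⟩ := hy
      obtain ⟨b, hb⟩ := hz
      exact ⟨a + b, by rw [map_add, ha, hb, TensorProduct.add_tmul]⟩
  · rintro ⟨a, rfl⟩
    have hη : η ∈ circleCalculus.leftCoinvariants L n := h ▸ Submodule.mem_span_singleton_self η
    exact ⟨a ⊗ₜ ⟨η, hη⟩, rfl⟩

theorem verticalForms_of_two_le (A : Type*) [Ring A] [Algebra ℂ A]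
    (L : CircleForms →ₐ[ℂ] ℂ[T;T⁻¹] ⊗[ℂ] CircleForms) {n : ℕ}
    (hn : 2 ≤ n) : verticalForms A circleCalculus L n = ⊥ := by
  have h : circleCalculus.leftCoinvariants L n = Submodule.span ℂ {0} := by
    rw [leftCoinvariants_of_two_le L hn, Submodule.span_zero_singleton]
  refine eq_bot_iff.2 fun x hx => ?_
  obtain ⟨a, rfl⟩ := (mem_verticalForms_of_span h x).1 hx
  simp

/-! ### The Cartan–Maurer form and the adjoint coaction -/

/-- The projection `ω ↦ S(ω₋₁) ω₀` sends every `tⁿ dt` to the invariant form `t⁻¹ dt`. -/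
theorem coinvariantProj_inr {L : CircleForms →ₐ[ℂ] ℂ[T;T⁻¹] ⊗[ℂ] CircleForms}
    (hL : circleCalculus.IsLeftCoaction L) (n : ℤ) :
    circleCalculus.coinvariantProj L (inr (T n)) = inr (T (-1)) := by
  simp only [coinvariantProj, LinearMap.comp_apply, AlgHom.toLinearMap_apply, leftCoaction_inr hL,
    TensorProduct.map_tmul, antipode_T, circle_incl, LinearMap.id_apply, LinearMap.mul'_apply,
    inl_mul_inr, smul_eq_mul, ← T_add]
  congr 2
  ring

/-- Since `ℂ[t, t⁻¹]` is commutative and cocommutative, its adjoint coaction is trivial. -/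
theorem adjoint_eq (h : ℂ[T;T⁻¹]) : adjoint ℂ ℂ[T;T⁻¹] h = h ⊗ₜ 1 := by
  have e : adjoint ℂ ℂ[T;T⁻¹] = (TensorProduct.mk ℂ ℂ[T;T⁻¹] ℂ[T;T⁻¹]).flip 1 := by
    refine CircleForms.lin_ext fun n => ?_
    simp only [adjoint, LinearMap.comp_apply, comul_T, TensorProduct.map_tmul, LinearMap.id_apply,
      LinearEquiv.coe_coe, TensorProduct.leftComm_tmul, antipode_T, LinearMap.mul'_apply, ← T_add,
      neg_add_cancel, T_zero, LinearMap.flip_apply, TensorProduct.mk_apply]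
  exact LinearMap.congr_fun e h

/-- The trivial coaction `ϑ ↦ ϑ ⊗ 1` is the adjoint coaction on `Λ¹`. -/
theorem isAdjointCoaction_trivial (L : CircleForms →ₐ[ℂ] ℂ[T;T⁻¹] ⊗[ℂ] CircleForms) :
    circleCalculus.IsAdjointCoaction L ((TensorProduct.mk ℂ _ ℂ[T;T⁻¹]).flip 1) := by
  intro ϑ h e
  rw [adjoint_eq, TensorProduct.map_tmul, ← e]
  rfl

/-! ### Bicovariance of the calculus on the circle -/

/-- The algebra morphism on the forms of the circle with prescribed restriction `G` to functions
and prescribed image `W` of `dt`. -/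
def circleLift {R : Type*} [Ring R] [Algebra ℂ R] (G : ℂ[T;T⁻¹] →ₐ[ℂ] R) (W : R) (hW : W * W = 0)
    (hc : ∀ n, W * G (T n) = G (T n) * W) : CircleForms →ₐ[ℂ] R :=
  have hc' : ∀ h, W * G h = G h * W := fun h => LinearMap.congr_fun
    (CircleForms.lin_ext (f := LinearMap.mulLeft ℂ W ∘ₗ G.toLinearMap)
      (g := LinearMap.mulRight ℂ W ∘ₗ G.toLinearMap) hc) h
  TrivSqZeroExt.lift G (LinearMap.mulRight ℂ W ∘ₗ G.toLinearMap)
    (fun x y => by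
      change G x * W * (G y * W) = 0
      rw [mul_assoc, ← mul_assoc W, hc', mul_assoc (G y), hW, mul_zero, mul_zero])
    (fun r x => by
      change G (r * x) * W = G r * (G x * W)
      rw [map_mul, mul_assoc])
    (fun r x => by
      change G (x * r) * W = G x * W * G r
      rw [map_mul, mul_assoc, mul_assoc, hc'])

/-- Forms `f + g dt` are sent to `G(f) + G(g) W`. -/
theorem circleLift_apply {R : Type*} [Ring R] [Algebra ℂ R] (G : ℂ[T;T⁻¹] →ₐ[ℂ] R) (W : R)
    (hW : W * W = 0) (hc : ∀ n, W * G (T n) = G (T n) * W) (ω : CircleForms) :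
    circleLift G W hW hc ω = G ω.fst + G ω.snd * W := rfl

theorem circleLift_inl {R : Type*} [Ring R] [Algebra ℂ R] (G : ℂ[T;T⁻¹] →ₐ[ℂ] R) (W : R)
    (hW : W * W = 0) (hc : ∀ n, W * G (T n) = G (T n) * W) (h : ℂ[T;T⁻¹]) :
    circleLift G W hW hc (inl h) = G h := by
  rw [circleLift_apply, fst_inl, snd_inl, map_zero, zero_mul, add_zero]

theorem circleLift_inr {R : Type*} [Ring R] [Algebra ℂ R] (G : ℂ[T;T⁻¹] →ₐ[ℂ] R) (W : R)
    (hW : W * W = 0) (hc : ∀ n, W * G (T n) = G (T n) * W) (h : ℂ[T;T⁻¹]) :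
    circleLift G W hW hc (inr h) = G h * W := by
  rw [circleLift_apply, fst_inr, snd_inr, map_zero, zero_add]

theorem inr_eq_inl_mul (h : ℂ[T;T⁻¹]) : (inl h * inr 1 : CircleForms) = inr h := by
  rw [inl_mul_inr, smul_eq_mul, mul_one]

theorem leftFun_T (n : ℤ) : (Algebra.TensorProduct.map (AlgHom.id ℂ ℂ[T;T⁻¹])
    circleCalculus.incl).comp (Bialgebra.comulAlgHom ℂ ℂ[T;T⁻¹]) (T n) = T n ⊗ₜ inl (T n) := by
  rw [AlgHom.comp_apply, Bialgebra.comulAlgHom_apply, comul_T, Algebra.TensorProduct.map_tmul]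
  rfl

theorem rightFun_T (n : ℤ) : (Algebra.TensorProduct.map circleCalculus.incl
    (AlgHom.id ℂ ℂ[T;T⁻¹])).comp (Bialgebra.comulAlgHom ℂ ℂ[T;T⁻¹]) (T n) = inl (T n) ⊗ₜ T n := by
  rw [AlgHom.comp_apply, Bialgebra.comulAlgHom_apply, comul_T, Algebra.TensorProduct.map_tmul]
  rfl

/-- The left coaction `tⁿ ↦ tⁿ ⊗ tⁿ`, `tⁿ dt ↦ tⁿ⁺¹ ⊗ tⁿ dt`. -/
def circleLeftCoaction : CircleForms →ₐ[ℂ] ℂ[T;T⁻¹] ⊗[ℂ] CircleForms :=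
  circleLift
    ((Algebra.TensorProduct.map (AlgHom.id ℂ ℂ[T;T⁻¹]) circleCalculus.incl).comp
      (Bialgebra.comulAlgHom ℂ ℂ[T;T⁻¹]))
    (T 1 ⊗ₜ inr 1)
    (by rw [Algebra.TensorProduct.tmul_mul_tmul, inr_mul_inr, TensorProduct.tmul_zero])
    (fun n => by
      rw [leftFun_T, Algebra.TensorProduct.tmul_mul_tmul, Algebra.TensorProduct.tmul_mul_tmul,
        mul_comm, mul_comm (inr 1 : CircleForms)])

/-- The right coaction `tⁿ ↦ tⁿ ⊗ tⁿ`, `tⁿ dt ↦ tⁿ dt ⊗ tⁿ⁺¹`. -/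
def circleRightCoaction : CircleForms →ₐ[ℂ] CircleForms ⊗[ℂ] ℂ[T;T⁻¹] :=
  circleLift
    ((Algebra.TensorProduct.map circleCalculus.incl (AlgHom.id ℂ ℂ[T;T⁻¹])).comp
      (Bialgebra.comulAlgHom ℂ ℂ[T;T⁻¹]))
    (inr 1 ⊗ₜ T 1)
    (by rw [Algebra.TensorProduct.tmul_mul_tmul, inr_mul_inr, TensorProduct.zero_tmul])
    (fun n => by
      rw [rightFun_T, Algebra.TensorProduct.tmul_mul_tmul, Algebra.TensorProduct.tmul_mul_tmul,
        mul_comm (T 1), mul_comm (inr 1 : CircleForms)])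

theorem circleLeftCoaction_inl (n : ℤ) :
    circleLeftCoaction (inl (T n)) = T n ⊗ₜ inl (T n) := by
  rw [circleLeftCoaction, circleLift_inl, leftFun_T]

theorem circleLeftCoaction_inr (n : ℤ) :
    circleLeftCoaction (inr (T n)) = T (n + 1) ⊗ₜ inr (T n) := by
  rw [circleLeftCoaction, circleLift_inr, leftFun_T, Algebra.TensorProduct.tmul_mul_tmul, ← T_add,
    inr_eq_inl_mul]

theorem circleRightCoaction_inl (n : ℤ) :
    circleRightCoaction (inl (T n)) = inl (T n) ⊗ₜ T n := by
  rw [circleRightCoaction, circleLift_inl, rightFun_T]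

theorem circleRightCoaction_inr (n : ℤ) :
    circleRightCoaction (inr (T n)) = inr (T n) ⊗ₜ T (n + 1) := by
  rw [circleRightCoaction, circleLift_inr, rightFun_T, Algebra.TensorProduct.tmul_mul_tmul, ← T_add,
    inr_eq_inl_mul]

theorem circle_d_inl (n : ℤ) :
    circleCalculus.d (inl (T n)) = (n : ℂ) • inr (T (n - 1)) := by
  rw [circle_d, fst_inl, CircleForms.deriv_T, inr_smul]

theorem circle_d_inr (h : ℂ[T;T⁻¹]) : circleCalculus.d (inr h) = 0 := by
  rw [circle_d, fst_inr, map_zero, inr_zero]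

/-- Gradedness of a linear map on the forms of the circle only has to be checked on `tⁿ` and
`tⁿ dt`. -/
theorem circle_map_grade {M : Type*} [AddCommGroup M] [Module ℂ M] (f : CircleForms →ₗ[ℂ] M)
    (P : ℕ → Submodule ℂ M) (h0 : ∀ n, f (inl (T n)) ∈ P 0) (h1 : ∀ n, f (inr (T n)) ∈ P 1) :
    ∀ n, ∀ ω ∈ circleCalculus.grade n, f ω ∈ P n := by
  have key : ∀ (g : ℂ[T;T⁻¹] →ₗ[ℂ] CircleForms) (i : ℕ), (∀ n, f (g (T n)) ∈ P i) →
      ∀ h, f (g h) ∈ P i := by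
    intro g i hg h
    have e : (P i).mkQ ∘ₗ f ∘ₗ g = 0 :=
      CircleForms.lin_ext fun n => (Submodule.Quotient.mk_eq_zero _).2 (hg n)
    exact (Submodule.Quotient.mk_eq_zero _).1 (LinearMap.congr_fun e h)
  rintro (_ | _ | n) ω hω
  · have h : ω.snd = 0 := hω
    have e : ω = circleInl ω.fst := by ext1 <;> simp [h]
    rw [e]
    exact key circleInl 0 h0 _
  · have h : ω.fst = 0 := hω
    have e : ω = circleInr ω.snd := by ext1 <;> simp [h]
    rw [e]
    exact key circleInr 1 h1 _
  · have h : ω = 0 := hω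
    rw [h, map_zero]
    exact Submodule.zero_mem _

theorem circleLeftCoaction_isLeftCoaction :
    circleCalculus.IsLeftCoaction circleLeftCoaction where
  extend h := circleLift_inl _ _ _ _ h
  map_d ω := by
    refine LinearMap.congr_fun (f := circleLeftCoaction.toLinearMap ∘ₗ circleCalculus.d)
      (g := TensorProduct.map LinearMap.id circleCalculus.d ∘ₗ circleLeftCoaction.toLinearMap)
      (circle_lin_ext (fun n => ?_) fun n => ?_) ω
    · simp only [LinearMap.comp_apply, AlgHom.toLinearMap_apply, circleLeftCoaction_inl,
        circle_d_inl, map_smul, circleLeftCoaction_inr, TensorProduct.map_tmul, LinearMap.id_apply,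
        TensorProduct.tmul_smul, sub_add_cancel]
    · simp only [LinearMap.comp_apply, AlgHom.toLinearMap_apply, circleLeftCoaction_inr,
        circle_d_inr, map_zero, TensorProduct.map_tmul, TensorProduct.tmul_zero]
  map_grade := circle_map_grade circleLeftCoaction.toLinearMap
    (fun n => LinearMap.range (TensorProduct.map LinearMap.id (circleCalculus.grade n).subtype))
    (fun n => ⟨T n ⊗ₜ ⟨inl (T n), circle_inl_mem _⟩, (circleLeftCoaction_inl n).symm⟩)
    (fun n => ⟨T (n + 1) ⊗ₜ ⟨inr (T n), circle_inr_mem _⟩, (circleLeftCoaction_inr n).symm⟩)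
  coassoc ω := by
    refine LinearMap.congr_fun
      (f := (TensorProduct.assoc ℂ ℂ[T;T⁻¹] ℂ[T;T⁻¹] CircleForms).toLinearMap ∘ₗ
        TensorProduct.map Coalgebra.comul LinearMap.id ∘ₗ circleLeftCoaction.toLinearMap)
      (g := TensorProduct.map LinearMap.id circleLeftCoaction.toLinearMap ∘ₗ
        circleLeftCoaction.toLinearMap)
      (circle_lin_ext (fun n => ?_) fun n => ?_) ω <;>
    simp only [LinearMap.comp_apply, AlgHom.toLinearMap_apply, circleLeftCoaction_inl,
        circleLeftCoaction_inr, TensorProduct.map_tmul, LinearMap.id_apply, LinearEquiv.coe_coe,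
        comul_T, TensorProduct.assoc_tmul]
  counit ω := by
    refine LinearMap.congr_fun
      (f := (TensorProduct.lid ℂ CircleForms).toLinearMap ∘ₗ
        TensorProduct.map Coalgebra.counit LinearMap.id ∘ₗ circleLeftCoaction.toLinearMap)
      (g := LinearMap.id)
      (circle_lin_ext (fun n => ?_) fun n => ?_) ω <;>
    simp only [LinearMap.comp_apply, AlgHom.toLinearMap_apply, circleLeftCoaction_inl,
        circleLeftCoaction_inr, TensorProduct.map_tmul, LinearMap.id_apply, LinearEquiv.coe_coe,
        counit_T, TensorProduct.lid_tmul, one_smul]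

theorem circleRightCoaction_isRightCoaction :
    circleCalculus.IsRightCoaction circleRightCoaction where
  extend h := circleLift_inl _ _ _ _ h
  map_d ω := by
    refine LinearMap.congr_fun (f := circleRightCoaction.toLinearMap ∘ₗ circleCalculus.d)
      (g := TensorProduct.map circleCalculus.d LinearMap.id ∘ₗ circleRightCoaction.toLinearMap)
      (circle_lin_ext (fun n => ?_) fun n => ?_) ω
    · simp only [LinearMap.comp_apply, AlgHom.toLinearMap_apply, circleRightCoaction_inl,
        circle_d_inl, map_smul, circleRightCoaction_inr, TensorProduct.map_tmul,
        LinearMap.id_apply, TensorProduct.smul_tmul', sub_add_cancel]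
    · simp only [LinearMap.comp_apply, AlgHom.toLinearMap_apply, circleRightCoaction_inr,
        circle_d_inr, map_zero, TensorProduct.map_tmul, TensorProduct.zero_tmul]
  map_grade := circle_map_grade circleRightCoaction.toLinearMap
    (fun n => LinearMap.range (TensorProduct.map (circleCalculus.grade n).subtype LinearMap.id))
    (fun n => ⟨⟨inl (T n), circle_inl_mem _⟩ ⊗ₜ T n, (circleRightCoaction_inl n).symm⟩)
    (fun n => ⟨⟨inr (T n), circle_inr_mem _⟩ ⊗ₜ T (n + 1), (circleRightCoaction_inr n).symm⟩)
  coassoc ω := by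
    refine LinearMap.congr_fun
      (f := (TensorProduct.assoc ℂ CircleForms ℂ[T;T⁻¹] ℂ[T;T⁻¹]).toLinearMap ∘ₗ
        TensorProduct.map circleRightCoaction.toLinearMap LinearMap.id ∘ₗ
          circleRightCoaction.toLinearMap)
      (g := TensorProduct.map LinearMap.id Coalgebra.comul ∘ₗ circleRightCoaction.toLinearMap)
      (circle_lin_ext (fun n => ?_) fun n => ?_) ω <;>
    simp only [LinearMap.comp_apply, AlgHom.toLinearMap_apply, circleRightCoaction_inl,
        circleRightCoaction_inr, TensorProduct.map_tmul, LinearMap.id_apply, LinearEquiv.coe_coe,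
        comul_T, TensorProduct.assoc_tmul]
  counit ω := by
    refine LinearMap.congr_fun
      (f := (TensorProduct.rid ℂ CircleForms).toLinearMap ∘ₗ
        TensorProduct.map LinearMap.id Coalgebra.counit ∘ₗ circleRightCoaction.toLinearMap)
      (g := LinearMap.id)
      (circle_lin_ext (fun n => ?_) fun n => ?_) ω <;>
    simp only [LinearMap.comp_apply, AlgHom.toLinearMap_apply, circleRightCoaction_inl,
        circleRightCoaction_inr, TensorProduct.map_tmul, LinearMap.id_apply, LinearEquiv.coe_coe,
        counit_T, TensorProduct.rid_tmul, one_smul]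

theorem circle_isBicovariant : circleCalculus.IsBicovariant :=
  ⟨⟨_, circleLeftCoaction_isLeftCoaction⟩, _, circleRightCoaction_isRightCoaction⟩

/-! ### Algebra morphisms on the forms of the torus -/

variable {θ : ℝ}

/-- Forms are generated by functions together with `du` and `dv`, so an algebra morphism on forms is
determined by its values there. -/
theorem TorusForms.eq_sum (ω : TorusForms θ) : ω = TorusForms.ofTorus ω.c +
    TorusForms.ofTorus ω.cu * ⟨0, 1, 0, 0⟩ + TorusForms.ofTorus ω.cv * ⟨0, 0, 1, 0⟩ +
    TorusForms.ofTorus ω.cuv * (⟨0, 1, 0, 0⟩ * ⟨0, 0, 1, 0⟩) := by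
  ext1 <;> simp

/-- The algebra morphism on the forms of the torus with prescribed restriction `G` to functions
and prescribed images `U`, `V` of `du`, `dv`. -/
def torusLift {R : Type*} [Ring R] [Algebra ℂ R] (G : Torus θ →ₐ[ℂ] R) (U V : R)
    (hU : ∀ m n, U * G (Torus.mono m n) = G (TorusForms.twistU (Torus.mono m n)) * U)
    (hV : ∀ m n, V * G (Torus.mono m n) = G (TorusForms.twistV (Torus.mono m n)) * V)
    (hUU : U * U = 0) (hVV : V * V = 0) (hVU : V * U = -(phase θ • (U * V))) :
    TorusForms θ →ₐ[ℂ] R :=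
  have hU' : ∀ a, U * G a = G (TorusForms.twistU a) * U := fun a => LinearMap.congr_fun
    (Torus.lin_ext (f := LinearMap.mulLeft ℂ U ∘ₗ G.toLinearMap)
      (g := LinearMap.mulRight ℂ U ∘ₗ (G.comp TorusForms.twistU).toLinearMap) hU) a
  have hV' : ∀ a, V * G a = G (TorusForms.twistV a) * V := fun a => LinearMap.congr_fun
    (Torus.lin_ext (f := LinearMap.mulLeft ℂ V ∘ₗ G.toLinearMap)
      (g := LinearMap.mulRight ℂ V ∘ₗ (G.comp TorusForms.twistV).toLinearMap) hV) a
  have hU2 : ∀ a z, U * (G a * z) = G (TorusForms.twistU a) * (U * z) := fun a z => by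
    rw [← mul_assoc, hU', mul_assoc]
  have hV2 : ∀ a z, V * (G a * z) = G (TorusForms.twistV a) * (V * z) := fun a z => by
    rw [← mul_assoc, hV', mul_assoc]
  have hUU2 : ∀ z, U * (U * z) = 0 := fun z => by rw [← mul_assoc, hUU, zero_mul]
  have hVU2 : ∀ z, V * (U * z) = -(phase θ • (U * (V * z))) := fun z => by
    rw [← mul_assoc, hVU, neg_mul, smul_mul_assoc, mul_assoc]
  AlgHom.ofLinearMap
    { toFun := fun ω => G ω.c + G ω.cu * U + G ω.cv * V + G ω.cuv * (U * V)
      map_add' := fun x y => by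
        simp only [TorusForms.add_c, TorusForms.add_cu, TorusForms.add_cv, TorusForms.add_cuv,
          map_add, add_mul]
        abel
      map_smul' := fun r x => by
        simp only [TorusForms.smul_c, TorusForms.smul_cu, TorusForms.smul_cv, TorusForms.smul_cuv,
          map_smul, smul_mul_assoc, smul_add, RingHom.id_apply] }
    (by simp)
    (fun x y => by
      simp only [LinearMap.coe_mk, AddHom.coe_mk, TorusForms.mul_c, TorusForms.mul_cu,
        TorusForms.mul_cv, TorusForms.mul_cuv, map_add, map_sub, map_mul, map_smul, add_mul,
        mul_add, sub_mul, mul_assoc, hU', hV', hU2, hV2, hUU, hVV, hVU, hUU2, hVU2, mul_zero,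
        smul_mul_assoc, mul_smul_comm, mul_neg, smul_zero, neg_zero, add_zero]
      abel)

/-! ### The coaction on the forms of the torus -/

/-- The form `du`. -/
def formU (θ : ℝ) : TorusForms θ := ⟨0, 1, 0, 0⟩
/-- The form `dv`. -/
def formV (θ : ℝ) : TorusForms θ := ⟨0, 0, 1, 0⟩

theorem formU_mem : formU θ ∈ (torusCalculus θ).grade 1 := ⟨rfl, rfl⟩
theorem formV_mem : formV θ ∈ (torusCalculus θ).grade 1 := ⟨rfl, rfl⟩

theorem formUV_mem : formU θ * formV θ ∈ (torusCalculus θ).grade 2 :=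
  SetLike.GradedMul.mul_mem formU_mem formV_mem

theorem torus_incl (a : Torus θ) : (torusCalculus θ).incl a = TorusForms.ofTorus a := rfl

theorem torus_d (ω : TorusForms θ) : (torusCalculus θ).d ω = TorusForms.d ω := rfl

theorem torusCoaction_mono (m n : ℤ) :
    torusCoaction θ (Torus.mono m n) = Torus.mono m n ⊗ₜ T (m - n) :=
  Torus.homOfMono_mono _ _ _ m n

/-- The coaction as a morphism `A → Ω(A) ⊗ Ω(H)`. -/
def coactionHom (θ : ℝ) : Torus θ →ₐ[ℂ] (torusCalculus θ).Tensor circleCalculus :=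
  ((torusCalculus θ).tensorIncl circleCalculus).comp (torusCoaction θ)

theorem coactionHom_apply (a : Torus θ) : coactionHom θ a =
    (torusCalculus θ).tensorIncl circleCalculus (torusCoaction θ a) := rfl

theorem coactionHom_mono (m n : ℤ) : coactionHom θ (Torus.mono m n) =
    (torusCalculus θ).tprod circleCalculus (TorusForms.ofTorus (Torus.mono m n))
      (inl (T (m - n))) := by
  rw [coactionHom_apply, torusCoaction_mono, tensorIncl_tmul]
  rfl

/-- The image `du ⊗ t + u ⊗ dt` of `du`. -/
def coactU (θ : ℝ) : (torusCalculus θ).Tensor circleCalculus :=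
  (torusCalculus θ).tprod circleCalculus (formU θ) (inl (T 1)) +
    (torusCalculus θ).tprod circleCalculus (TorusForms.ofTorus (Torus.mono 1 0)) (inr (T 0))

/-- The image `dv ⊗ t⁻¹ - v ⊗ t⁻² dt` of `dv`. -/
def coactV (θ : ℝ) : (torusCalculus θ).Tensor circleCalculus :=
  (torusCalculus θ).tprod circleCalculus (formV θ) (inl (T (-1))) -
    (torusCalculus θ).tprod circleCalculus (TorusForms.ofTorus (Torus.mono 0 1)) (inr (T (-2)))

theorem tprod_inl_mul (x z : TorusForms θ) (h : ℂ[T;T⁻¹]) (w : CircleForms) {j : ℕ}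
    (hz : z ∈ (torusCalculus θ).grade j) :
    (torusCalculus θ).tprod circleCalculus x (inl h) * (torusCalculus θ).tprod circleCalculus z w =
      (torusCalculus θ).tprod circleCalculus (x * z) (inl h * w) := by
  rw [tprod_mul_tprod _ (circle_inl_mem h) hz, zero_mul, pow_zero, one_smul]

theorem tprod_inr_mul_zero (x z : TorusForms θ) (h : ℂ[T;T⁻¹]) (w : CircleForms)
    (hz : z ∈ (torusCalculus θ).grade 0) :
    (torusCalculus θ).tprod circleCalculus x (inr h) * (torusCalculus θ).tprod circleCalculus z w =
      (torusCalculus θ).tprod circleCalculus (x * z) (inr h * w) := by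
  rw [tprod_mul_tprod _ (circle_inr_mem h) hz, mul_zero, pow_zero, one_smul]

theorem tprod_inr_mul_one (x z : TorusForms θ) (h : ℂ[T;T⁻¹]) (w : CircleForms)
    (hz : z ∈ (torusCalculus θ).grade 1) :
    (torusCalculus θ).tprod circleCalculus x (inr h) * (torusCalculus θ).tprod circleCalculus z w =
      -(torusCalculus θ).tprod circleCalculus (x * z) (inr h * w) := by
  rw [tprod_mul_tprod _ (circle_inr_mem h) hz, mul_one, pow_one, neg_one_smul]

theorem ofTorus_mem (a : Torus θ) : TorusForms.ofTorus a ∈ (torusCalculus θ).grade 0 :=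
  ⟨rfl, rfl, rfl⟩

theorem ofTorus_mul_mem (a : Torus θ) {n : ℕ} {x : TorusForms θ}
    (hx : x ∈ (torusCalculus θ).grade n) : TorusForms.ofTorus a * x ∈ (torusCalculus θ).grade n :=
  incl_mul_mem (C := torusCalculus θ) a hx

theorem inl_T_mul_inl_T (m n : ℤ) : (inl (T m) * inl (T n) : CircleForms) = inl (T (m + n)) := by
  rw [inl_mul_inl, ← T_add]
theorem inl_T_mul_inr_T (m n : ℤ) : (inl (T m) * inr (T n) : CircleForms) = inr (T (m + n)) := by
  rw [inl_mul_inr, smul_eq_mul, ← T_add]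
theorem inr_T_mul_inl_T (m n : ℤ) : (inr (T m) * inl (T n) : CircleForms) = inr (T (m + n)) := by
  rw [mul_comm, inl_T_mul_inr_T, add_comm]

/-- `du a = σ(a) du`. -/
theorem formU_mul_ofTorus (a : Torus θ) : formU θ * TorusForms.ofTorus a =
    TorusForms.ofTorus (TorusForms.twistU a) * formU θ := by
  ext1 <;> simp [formU]
/-- `dv a = τ(a) dv`. -/
theorem formV_mul_ofTorus (a : Torus θ) : formV θ * TorusForms.ofTorus a =
    TorusForms.ofTorus (TorusForms.twistV a) * formV θ := by
  ext1 <;> simp [formV]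
theorem formU_mul_formU : formU θ * formU θ = 0 := by ext1 <;> simp [formU]
theorem formV_mul_formV : formV θ * formV θ = 0 := by ext1 <;> simp [formV]
theorem formV_mul_formU : formV θ * formU θ = -(phase θ • (formU θ * formV θ)) := by
  ext1 <;> simp [formU, formV]

theorem q_zpow (n : ℤ) : ((TorusForms.q θ ^ n : ℂˣ) : ℂ) = phase θ ^ n := by
  rw [Units.val_zpow_eq_zpow_val]; rfl

theorem twistU_mono (m n : ℤ) : TorusForms.twistU (Torus.mono m n : Torus θ) =
    phase θ ^ (-n) • Torus.mono m n := by
  rw [TorusForms.twistU, Torus.scale_mono, one_zpow, one_mul, inv_zpow', q_zpow]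

theorem twistV_mono (m n : ℤ) : TorusForms.twistV (Torus.mono m n : Torus θ) =
    phase θ ^ m • Torus.mono m n := by
  rw [TorusForms.twistV, Torus.scale_mono, one_zpow, mul_one, q_zpow]

/-- `σ(a) u = u a`. -/
theorem twistU_mul_u (a : Torus θ) : TorusForms.twistU a * Torus.mono 1 0 = Torus.mono 1 0 * a :=
  LinearMap.congr_fun (Torus.lin_ext
    (f := LinearMap.mulRight ℂ (Torus.mono 1 0) ∘ₗ TorusForms.twistU.toLinearMap)
    (g := LinearMap.mulLeft ℂ (Torus.mono 1 0)) fun m n => by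
      have h0 := phase_ne_zero θ
      simp only [LinearMap.comp_apply, AlgHom.toLinearMap_apply, twistU_mono,
        LinearMap.mulRight_apply, LinearMap.mulLeft_apply, smul_mul_assoc, Torus.mono_mul_mono,
        smul_smul, ← zpow_add₀ h0, mul_one, zero_mul, add_zero, add_comm, add_neg_cancel]) a

/-- `τ(a) v = v a`. -/
theorem twistV_mul_v (a : Torus θ) : TorusForms.twistV a * Torus.mono 0 1 = Torus.mono 0 1 * a :=
  LinearMap.congr_fun (Torus.lin_ext
    (f := LinearMap.mulRight ℂ (Torus.mono 0 1) ∘ₗ TorusForms.twistV.toLinearMap)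
    (g := LinearMap.mulLeft ℂ (Torus.mono 0 1)) fun m n => by
      simp only [LinearMap.comp_apply, AlgHom.toLinearMap_apply, twistV_mono,
        LinearMap.mulRight_apply, LinearMap.mulLeft_apply, smul_mul_assoc, Torus.mono_mul_mono,
        mul_zero, one_mul, add_zero, zpow_zero, one_smul, add_comm]) a

theorem coactU_mul_coactionHom (m n : ℤ) : coactU θ * coactionHom θ (Torus.mono m n) =
    coactionHom θ (TorusForms.twistU (Torus.mono m n)) * coactU θ := by
  have e := twistU_mul_u (θ := θ) (Torus.mono m n)
  rw [twistU_mono] at e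
  rw [twistU_mono, map_smul, coactionHom_mono, coactU, add_mul, smul_mul_assoc, mul_add,
    tprod_inl_mul _ _ _ _ (ofTorus_mem _), tprod_inr_mul_zero _ _ _ _ (ofTorus_mem _),
    tprod_inl_mul _ _ _ _ formU_mem, tprod_inl_mul _ _ _ _ (ofTorus_mem _), formU_mul_ofTorus,
    twistU_mono, ← map_mul, ← map_mul, ← e, inl_T_mul_inl_T, inl_T_mul_inl_T, inr_T_mul_inl_T,
    inl_T_mul_inr_T, smul_add, ← smul_tprod, ← smul_tprod, map_smul, smul_mul_assoc, smul_mul_assoc,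
    map_smul, add_comm 1, zero_add, add_zero]

theorem coactV_mul_coactionHom (m n : ℤ) : coactV θ * coactionHom θ (Torus.mono m n) =
    coactionHom θ (TorusForms.twistV (Torus.mono m n)) * coactV θ := by
  have e := twistV_mul_v (θ := θ) (Torus.mono m n)
  rw [twistV_mono] at e
  rw [twistV_mono, map_smul, coactionHom_mono, coactV, sub_mul, smul_mul_assoc, mul_sub,
    tprod_inl_mul _ _ _ _ (ofTorus_mem _), tprod_inr_mul_zero _ _ _ _ (ofTorus_mem _),
    tprod_inl_mul _ _ _ _ formV_mem, tprod_inl_mul _ _ _ _ (ofTorus_mem _), formV_mul_ofTorus,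
    twistV_mono, ← map_mul, ← map_mul, ← e, inl_T_mul_inl_T, inl_T_mul_inl_T, inr_T_mul_inl_T,
    inl_T_mul_inr_T, smul_sub, ← smul_tprod, ← smul_tprod, map_smul, smul_mul_assoc, smul_mul_assoc,
    map_smul, add_comm (-1), add_comm (-2)]

theorem coactU_mul_coactU : coactU θ * coactU θ = 0 := by
  rw [coactU, add_mul, mul_add, mul_add, tprod_inl_mul _ _ _ _ formU_mem,
    tprod_inl_mul _ _ _ _ (ofTorus_mem _), tprod_inr_mul_one _ _ _ _ formU_mem,
    tprod_inr_mul_zero _ _ _ _ (ofTorus_mem _), formU_mul_formU, tprod_zero_left, inr_mul_inr,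
    tprod_zero_right,
    formU_mul_ofTorus, twistU_mono, neg_zero, zpow_zero, one_smul, inl_T_mul_inr_T,
    inr_T_mul_inl_T, zero_add, add_zero, add_zero, zero_add, add_neg_cancel]

theorem coactV_mul_coactV : coactV θ * coactV θ = 0 := by
  rw [coactV, sub_mul, mul_sub, mul_sub, tprod_inl_mul _ _ _ _ formV_mem,
    tprod_inl_mul _ _ _ _ (ofTorus_mem _), tprod_inr_mul_one _ _ _ _ formV_mem,
    tprod_inr_mul_zero _ _ _ _ (ofTorus_mem _), formV_mul_formV, tprod_zero_left, inr_mul_inr,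
    tprod_zero_right,
    formV_mul_ofTorus, twistV_mono, zpow_zero, one_smul, inl_T_mul_inr_T,
    inr_T_mul_inl_T, add_comm (-2)]
  abel

/-- The image of `du ∧ dv`. The first coefficient of `t⁻¹ dt` comes from
`du v = exp (- i θ) v du`, the second one carries the sign of interchanging `dt` and `dv`. -/
theorem coactU_mul_coactV : coactU θ * coactV θ =
    (torusCalculus θ).tprod circleCalculus (formU θ * formV θ) (inl (T 0)) -
      (phase θ)⁻¹ • (torusCalculus θ).tprod circleCalculus
        (TorusForms.ofTorus (Torus.mono 0 1) * formU θ) (inr (T (-1))) -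
      (torusCalculus θ).tprod circleCalculus
        (TorusForms.ofTorus (Torus.mono 1 0) * formV θ) (inr (T (-1))) := by
  rw [coactU, coactV, add_mul, mul_sub, mul_sub, tprod_inl_mul _ _ _ _ formV_mem,
    tprod_inl_mul _ _ _ _ (ofTorus_mem _), tprod_inr_mul_one _ _ _ _ formV_mem,
    tprod_inr_mul_zero _ _ _ _ (ofTorus_mem _), inr_mul_inr, tprod_zero_right, sub_zero,
    formU_mul_ofTorus, twistU_mono, zpow_neg_one, map_smul, smul_mul_assoc, smul_tprod,
    inl_T_mul_inl_T, inl_T_mul_inr_T, inr_T_mul_inl_T, zero_add, ← sub_eq_add_neg]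
  norm_num

theorem coactV_mul_coactU : coactV θ * coactU θ = -(phase θ • (coactU θ * coactV θ)) := by
  have h0 := phase_ne_zero θ
  rw [coactU_mul_coactV, coactU, coactV, sub_mul, mul_add, mul_add, tprod_inl_mul _ _ _ _ formU_mem,
    tprod_inl_mul _ _ _ _ (ofTorus_mem _), tprod_inr_mul_one _ _ _ _ formU_mem,
    tprod_inr_mul_zero _ _ _ _ (ofTorus_mem _), inr_mul_inr, tprod_zero_right, add_zero,
    formV_mul_ofTorus, twistV_mono, zpow_one, map_smul, smul_mul_assoc, smul_tprod,
    inl_T_mul_inl_T, inl_T_mul_inr_T, inr_T_mul_inl_T, formV_mul_formU, smul_sub, smul_sub,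
    smul_smul, mul_inv_cancel₀ h0, one_smul, ← neg_one_smul ℂ (phase θ • (formU θ * formV θ)),
    smul_smul, smul_tprod]
  norm_num
  abel

/-- The extension of the coaction to forms. -/
def formCoaction (θ : ℝ) : TorusForms θ →ₐ[ℂ] (torusCalculus θ).Tensor circleCalculus :=
  torusLift (coactionHom θ) (coactU θ) (coactV θ) coactU_mul_coactionHom coactV_mul_coactionHom
    coactU_mul_coactU coactV_mul_coactV coactV_mul_coactU

theorem formCoaction_apply (ω : TorusForms θ) : formCoaction θ ω =
    coactionHom θ ω.c + coactionHom θ ω.cu * coactU θ + coactionHom θ ω.cv * coactV θ +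
      coactionHom θ ω.cuv * (coactU θ * coactV θ) := rfl

theorem tensorD_coactionHom_mono (m n : ℤ) :
    (torusCalculus θ).tensorD circleCalculus (coactionHom θ (Torus.mono m n)) =
      coactionHom θ (TorusForms.partialU (Torus.mono m n)) * coactU θ +
        coactionHom θ (TorusForms.partialV (Torus.mono m n)) * coactV θ := by
  have h0 := phase_ne_zero θ
  have e : (torusCalculus θ).d (TorusForms.ofTorus (Torus.mono m n)) =
      (m * phase θ ^ (-n) : ℂ) • (TorusForms.ofTorus (Torus.mono (m - 1) n) * formU θ) +
        (n : ℂ) • (TorusForms.ofTorus (Torus.mono m (n - 1)) * formV θ) := by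
    rw [torus_d]; ext1 <;> simp [formU, formV]
  rw [TorusForms.partialU_mono, TorusForms.partialV_mono, map_smul, map_smul, smul_mul_assoc,
    smul_mul_assoc, coactionHom_mono, coactionHom_mono, coactionHom_mono, coactU, coactV, mul_add,
    mul_sub, tprod_inl_mul _ _ _ _ formU_mem, tprod_inl_mul _ _ _ _ formV_mem,
    tprod_inl_mul _ _ _ _ (ofTorus_mem _), tprod_inl_mul _ _ _ _ (ofTorus_mem _), ← map_mul,
    ← map_mul,
    Torus.mono_mul_mono, Torus.mono_mul_mono, tensorD_tprod (ofTorus_mem _), e, circle_d_inl,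
    inl_T_mul_inl_T, inl_T_mul_inl_T, inl_T_mul_inr_T, inl_T_mul_inr_T, pow_zero, one_smul,
    add_tprod, smul_tprod, smul_tprod, tprod_smul, map_smul, map_smul, smul_tprod, smul_tprod,
    mul_one, mul_zero,
    zpow_zero, one_smul, smul_add, smul_sub, smul_smul, mul_assoc, ← zpow_add₀ h0, neg_add_cancel,
    zpow_zero, mul_one, sub_add_cancel, add_zero, add_zero, sub_add_cancel,
    show m - 1 - n + 1 = m - n by ring, show m - (n - 1) + -1 = m - n by ring,
    add_zero, show m - 1 - n = m - n - 1 by ring, show m - (n - 1) + -2 = m - n - 1 by ring]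
  push_cast
  rw [sub_smul]
  abel

/-- The coaction commutes with `d` on functions: `d(Δ a) = Δ(∂ᵤ a) U + Δ(∂ᵥ a) V`, where `U` and `V`
are the images of `du` and `dv`. -/
theorem tensorD_coactionHom (a : Torus θ) :
    (torusCalculus θ).tensorD circleCalculus (coactionHom θ a) =
      coactionHom θ (TorusForms.partialU a) * coactU θ +
        coactionHom θ (TorusForms.partialV a) * coactV θ :=
  LinearMap.congr_fun (Torus.lin_ext
    (f := (torusCalculus θ).tensorD circleCalculus ∘ₗ (coactionHom θ).toLinearMap)
    (g := LinearMap.mulRight ℂ (coactU θ) ∘ₗ (coactionHom θ).toLinearMap ∘ₗ TorusForms.partialU +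
      LinearMap.mulRight ℂ (coactV θ) ∘ₗ (coactionHom θ).toLinearMap ∘ₗ TorusForms.partialV)
    tensorD_coactionHom_mono) a

theorem tensorD_coactU : (torusCalculus θ).tensorD circleCalculus (coactU θ) = 0 := by
  have e1 : (torusCalculus θ).d (TorusForms.ofTorus (Torus.mono 1 0)) = formU θ :=
    TorusForms.d_u
  have e2 : (torusCalculus θ).d (formU θ) = 0 := by
    rw [← e1]; exact (torusCalculus θ).d_d _
  rw [coactU, map_add, tensorD_tprod formU_mem, tensorD_tprod (ofTorus_mem _), e1, e2,
    tprod_zero_left,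
    circle_d_inl, circle_d_inr, tprod_zero_right, smul_zero, sub_self, pow_one, neg_one_smul,
    Int.cast_one, one_smul, zero_add, add_zero, neg_add_cancel]

theorem tensorD_coactV : (torusCalculus θ).tensorD circleCalculus (coactV θ) = 0 := by
  have e1 : (torusCalculus θ).d (TorusForms.ofTorus (Torus.mono 0 1)) = formV θ :=
    TorusForms.d_v
  have e2 : (torusCalculus θ).d (formV θ) = 0 := by
    rw [← e1]; exact (torusCalculus θ).d_d _
  rw [coactV, map_sub, tensorD_tprod formV_mem, tensorD_tprod (ofTorus_mem _), e1, e2,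
    tprod_zero_left,
    circle_d_inl, circle_d_inr, tprod_zero_right, smul_zero, tprod_smul]
  norm_num

theorem tensorD_coactU_mul_coactV :
    (torusCalculus θ).tensorD circleCalculus (coactU θ * coactV θ) = 0 := by
  have h0 := phase_ne_zero θ
  have e0 : (torusCalculus θ).d (formU θ * formV θ) = 0 := by
    rw [torus_d]; ext1 <;> simp [formU, formV]
  have e1 : (torusCalculus θ).d (TorusForms.ofTorus (Torus.mono 0 1) * formU θ) =
      -(phase θ • (formU θ * formV θ)) := by
    rw [torus_d]; ext1 <;> simp [formU, formV, ← Torus.one_eq]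
  have e2 : (torusCalculus θ).d (TorusForms.ofTorus (Torus.mono 1 0) * formV θ) =
      formU θ * formV θ := by
    rw [torus_d]; ext1 <;> simp [formU, formV, ← Torus.one_eq]
  rw [coactU_mul_coactV, map_sub, map_sub, map_smul, tensorD_tprod formUV_mem,
    tensorD_tprod (ofTorus_mul_mem (Torus.mono 0 1) formU_mem),
    tensorD_tprod (ofTorus_mul_mem (Torus.mono 1 0) formV_mem),
    e0, e1, e2, circle_d_inr, circle_d_inl, tprod_zero_right, tprod_zero_right, tprod_zero_left,
    tprod_smul, Int.cast_zero,
    zero_smul, smul_zero, smul_zero, add_zero, add_zero, add_zero, ← neg_smul, smul_tprod,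
    smul_smul,
    mul_neg, inv_mul_cancel₀ h0, neg_one_smul, sub_neg_eq_add, zero_add, sub_self]

/-- The extended coaction is a morphism of differential graded algebras: by the Leibniz rule for
factors of degree `0` it suffices to know the differentials of `Δ a` and of the images of `du`, `dv`
and `du ∧ dv`, and the latter three are closed. -/
theorem formCoaction_map_d (ω : TorusForms θ) : formCoaction θ ((torusCalculus θ).d ω) =
    (torusCalculus θ).tensorD circleCalculus (formCoaction θ ω) := by
  rw [formCoaction_apply ω]
  simp only [map_add, coactionHom_apply, tensorD_tensorIncl_mul, tensorD_coactU, tensorD_coactV,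
    tensorD_coactU_mul_coactV, mul_zero, add_zero]
  simp only [← coactionHom_apply, tensorD_coactionHom, add_mul, mul_assoc]
  rw [coactV_mul_coactU, ← mul_assoc (coactU θ), coactU_mul_coactU, coactV_mul_coactV,
    ← mul_assoc (coactV θ), coactV_mul_coactU, neg_mul,
    smul_mul_assoc, mul_assoc (coactU θ), coactV_mul_coactV, formCoaction_apply, torus_d]
  simp only [TorusForms.d_c, TorusForms.d_cu, TorusForms.d_cv, TorusForms.d_cuv, map_zero, zero_add,
    zero_mul, mul_zero, add_zero, smul_zero, neg_zero, map_sub, map_smul, sub_mul, mul_neg,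
    mul_smul_comm, smul_mul_assoc]
  abel

theorem coactU_mem : coactU θ ∈ (torusCalculus θ).tensorGrade circleCalculus 1 :=
  Submodule.add_mem _ (tprod_mem formU_mem (circle_inl_mem _) rfl)
    (tprod_mem (ofTorus_mem _) (circle_inr_mem _) rfl)

theorem coactV_mem : coactV θ ∈ (torusCalculus θ).tensorGrade circleCalculus 1 :=
  Submodule.sub_mem _ (tprod_mem formV_mem (circle_inl_mem _) rfl)
    (tprod_mem (ofTorus_mem _) (circle_inr_mem _) rfl)

theorem coactU_mul_coactV_mem :
    coactU θ * coactV θ ∈ (torusCalculus θ).tensorGrade circleCalculus 2 := by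
  rw [coactU_mul_coactV]
  exact Submodule.sub_mem _ (Submodule.sub_mem _ (tprod_mem formUV_mem (circle_inl_mem _) rfl)
    (Submodule.smul_mem _ _ (tprod_mem (ofTorus_mul_mem (Torus.mono 0 1) formU_mem)
      (circle_inr_mem _) rfl)))
    (tprod_mem (ofTorus_mul_mem (Torus.mono 1 0) formV_mem)
      (circle_inr_mem _) rfl)

theorem formCoaction_map_grade : ∀ n, ∀ ω ∈ (torusCalculus θ).grade n,
    formCoaction θ ω ∈ (torusCalculus θ).tensorGrade circleCalculus n := by
  rintro (_ | _ | _ | n) ω hω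
  · obtain ⟨h1, h2, h3⟩ := TorusForms.mem_grade_zero.1 hω
    rw [formCoaction_apply, h1, h2, h3]
    simp only [map_zero, zero_mul, add_zero]
    have h := tensorIncl_mul_mem (torusCoaction θ ω.c)
      (tprod_mem (C := torusCalculus θ) (D := circleCalculus) (ofTorus_mem 1) (circle_inl_mem 1)
        (add_zero 0))
    rwa [show (torusCalculus θ).tprod circleCalculus (TorusForms.ofTorus 1) (inl 1) = 1 from rfl,
      mul_one] at h
  · obtain ⟨h1, h2⟩ := TorusForms.mem_grade_one.1 hω
    rw [formCoaction_apply, h1, h2]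
    simp only [map_zero, zero_mul, add_zero, zero_add]
    exact Submodule.add_mem _ (tensorIncl_mul_mem _ coactU_mem) (tensorIncl_mul_mem _ coactV_mem)
  · obtain ⟨h1, h2, h3⟩ := TorusForms.mem_grade_two.1 hω
    rw [formCoaction_apply, h1, h2, h3]
    simp only [map_zero, zero_mul, zero_add]
    exact tensorIncl_mul_mem _ coactU_mul_coactV_mem
  · rw [TorusForms.mem_grade_add_three (n := n) |>.1 hω, map_zero]
    exact Submodule.zero_mem _

theorem formCoaction_isCoactionExtension :
    (torusCalculus θ).IsCoactionExtension circleCalculus (torusCoaction θ) (formCoaction θ) where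
  extend a := by
    rw [formCoaction_apply, torus_incl, TorusForms.ofTorus_c, TorusForms.ofTorus_cu,
      TorusForms.ofTorus_cv, TorusForms.ofTorus_cuv]
    simp only [map_zero, zero_mul, add_zero]
    rfl
  map_grade := formCoaction_map_grade
  map_d := formCoaction_map_d

/-! ### Components of the coaction -/

/-- An instance of `mul_neg` for `A ⊗ H`; as a `simp` lemma the general one does not apply to this
tensor product. -/
theorem tensor_mul_neg (x y : Torus θ ⊗[ℂ] ℂ[T;T⁻¹]) : x * -y = -(x * y) :=
  map_neg (LinearMap.mulLeft ℂ x) y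

/-- A coaction extension is unique, since `Ω(A)` is generated by functions and their
differentials. -/
theorem eq_formCoaction {F : TorusForms θ →ₐ[ℂ] (torusCalculus θ).Tensor circleCalculus}
    (hF : (torusCalculus θ).IsCoactionExtension circleCalculus (torusCoaction θ) F) :
    F = formCoaction θ := by
  have hG := formCoaction_isCoactionExtension (θ := θ)
  have h0 : ∀ a, F (TorusForms.ofTorus a) = formCoaction θ (TorusForms.ofTorus a) := fun a =>
    (hF.apply_incl a).trans (hG.apply_incl a).symm
  have h1 : ∀ a, F (TorusForms.d (TorusForms.ofTorus a)) =
      formCoaction θ (TorusForms.d (TorusForms.ofTorus a)) := fun a => by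
    rw [← torus_d, hF.map_d, hG.map_d, h0]
  have hu := h1 (Torus.u : (Torus θ)ˣ)
  have hv := h1 (Torus.v : (Torus θ)ˣ)
  rw [TorusForms.d_u] at hu
  rw [TorusForms.d_v] at hv
  ext1 ω
  rw [ω.eq_sum]
  simp only [map_add, map_mul, h0, hu, hv]

/-- The coefficient `c` of a form, as a linear map. -/
def coeffC (θ : ℝ) : TorusForms θ →ₗ[ℂ] Torus θ where
  toFun := TorusForms.c
  map_add' _ _ := rfl
  map_smul' _ _ := rfl

/-- The coefficient of `du`, as a linear map. -/
def coeffU (θ : ℝ) : TorusForms θ →ₗ[ℂ] Torus θ where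
  toFun := TorusForms.cu
  map_add' _ _ := rfl
  map_smul' _ _ := rfl

theorem coeffC_apply (ω : TorusForms θ) : coeffC θ ω = ω.c := rfl
theorem coeffU_apply (ω : TorusForms θ) : coeffU θ ω = ω.cu := rfl

theorem coeffC_mul (a : Torus θ) (x : TorusForms θ) :
    coeffC θ ((torusCalculus θ).incl a * x) = a * coeffC θ x := rfl
theorem coeffU_mul (a : Torus θ) (x : TorusForms θ) :
    coeffU θ ((torusCalculus θ).incl a * x) = a * coeffU θ x := by
  simp [coeffU_apply, torus_incl]

theorem circleFst_mul (h : ℂ[T;T⁻¹]) (y : CircleForms) :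
    circleFst (circleCalculus.incl h * y) = h * circleFst y := rfl
theorem circleSnd_mul (h : ℂ[T;T⁻¹]) (y : CircleForms) :
    circleSnd (circleCalculus.incl h * y) = h * circleSnd y := by
  simp [circle_incl]

/-- The components of the extended coaction along left linear maps, as elements of `A ⊗ H`. Every
property of a form below is read off from a suitable component. -/
theorem component_formCoaction {φ : TorusForms θ →ₗ[ℂ] Torus θ} {ψ : CircleForms →ₗ[ℂ] ℂ[T;T⁻¹]}
    (hφ : ∀ a x, φ ((torusCalculus θ).incl a * x) = a * φ x)
    (hψ : ∀ h y, ψ (circleCalculus.incl h * y) = h * ψ y) (ω : TorusForms θ) :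
    (torusCalculus θ).component circleCalculus φ ψ (formCoaction θ ω) =
      torusCoaction θ ω.c * φ 1 ⊗ₜ ψ 1 +
      torusCoaction θ ω.cu * (φ (formU θ) ⊗ₜ ψ (inl (T 1)) +
        φ (TorusForms.ofTorus (Torus.mono 1 0)) ⊗ₜ ψ (inr (T 0))) +
      torusCoaction θ ω.cv * (φ (formV θ) ⊗ₜ ψ (inl (T (-1))) -
        φ (TorusForms.ofTorus (Torus.mono 0 1)) ⊗ₜ ψ (inr (T (-2)))) +
      torusCoaction θ ω.cuv * (φ (formU θ * formV θ) ⊗ₜ ψ (inl (T 0)) -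
        (phase θ)⁻¹ • φ (TorusForms.ofTorus (Torus.mono 0 1) * formU θ) ⊗ₜ ψ (inr (T (-1))) -
        φ (TorusForms.ofTorus (Torus.mono 1 0) * formV θ) ⊗ₜ ψ (inr (T (-1)))) := by
  have h1 : (1 : (torusCalculus θ).Tensor circleCalculus) =
    (torusCalculus θ).tprod circleCalculus 1 1 := rfl
  rw [formCoaction_apply, ← mul_one (coactionHom θ ω.c)]
  simp only [coactionHom_apply, map_add, component_tensorIncl_mul hφ hψ]
  rw [coactU_mul_coactV, coactU, coactV, h1]
  simp only [map_add, map_sub, map_smul, component_tprod]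

/-- The counit is a left inverse of the coaction. -/
theorem torusCoaction_injective : Function.Injective (torusCoaction θ) := by
  have e : (TensorProduct.rid ℂ (Torus θ)).toLinearMap ∘ₗ
      TensorProduct.map LinearMap.id Coalgebra.counit ∘ₗ (torusCoaction θ).toLinearMap =
      LinearMap.id := by
    refine Torus.lin_ext fun m n => ?_
    simp only [LinearMap.comp_apply, LinearEquiv.coe_coe, AlgHom.toLinearMap_apply,
      torusCoaction_mono, TensorProduct.map_tmul, LinearMap.id_apply, counit_T,
      TensorProduct.rid_tmul, one_smul]
  intro a b h
  have := congrArg (fun z => TensorProduct.rid ℂ (Torus θ)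
    (TensorProduct.map LinearMap.id Coalgebra.counit z)) h
  exact (LinearMap.congr_fun e a).symm.trans (this.trans (LinearMap.congr_fun e b))

/-! ### Horizontal and base forms -/

theorem mul_mono_cancel {a b : Torus θ} (m n : ℤ) (h : a * Torus.mono m n = b * Torus.mono m n) :
    a = b := by
  rw [Torus.mono_eq, ← Units.val_mul] at h
  exact (Units.mul_left_inj _).1 h

/-- A horizontal form has no component along `du ∧ dv`, and its degree `1` part `f du + g dv`
satisfies `f u = g v`, that is, it is annihilated by the contraction with the vertical direction.
The two conditions are the coefficients of `du ⊗ dt` and of `1 ⊗ dt` in its coaction. -/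
theorem horizontal_coeff {ω : TorusForms θ} (h : ω ∈ horizontalForms (formCoaction θ)) :
    ω.cuv = 0 ∧ ω.cu * Torus.mono 1 0 = ω.cv * Torus.mono 0 1 := by
  have hs : ∀ y ∈ circleCalculus.grade 0, circleSnd y = 0 := fun y hy => hy
  constructor
  · have e := component_eq_zero_of_horizontal h (coeffU θ) hs
    rw [component_formCoaction coeffU_mul circleSnd_mul] at e
    simp only [circleSnd_apply, coeffU_apply, snd_one, snd_inl, snd_inr, TensorProduct.tmul_zero,
      TorusForms.ofTorus_cu, TensorProduct.zero_tmul, mul_zero, zero_add, add_zero, sub_zero,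
      zero_sub, TorusForms.mul_cu, formU, formV, TorusForms.ofTorus_c, mul_one, map_zero,
      tensor_mul_neg, neg_eq_zero, mul_smul_comm] at e
    rw [smul_eq_zero_iff_right (inv_ne_zero (phase_ne_zero θ))] at e
    have e2 : torusCoaction θ (ω.cuv * Torus.mono 0 1) = 0 := by
      rw [map_mul, torusCoaction_mono, zero_sub, e]
    rw [map_eq_zero_iff _ torusCoaction_injective] at e2
    exact mul_mono_cancel 0 1 (e2.trans (zero_mul _).symm)
  · have e := component_eq_zero_of_horizontal h (coeffC θ) hs
    rw [component_formCoaction coeffC_mul circleSnd_mul] at e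
    simp only [circleSnd_apply, coeffC_apply, snd_one, snd_inl, snd_inr, TensorProduct.tmul_zero,
      TorusForms.ofTorus_c, mul_zero, zero_add, add_zero, sub_zero,
      zero_sub, TorusForms.mul_c, formU, formV, TensorProduct.zero_tmul, smul_zero,
      tensor_mul_neg, ← sub_eq_add_neg] at e
    apply torusCoaction_injective
    rw [map_mul, map_mul, torusCoaction_mono, torusCoaction_mono]
    -- `u` has weight `1` and `v` has weight `-1`, so both sides are off by the same factor `t⁻¹`
    have e2 := congrArg (· * ((1 : Torus θ) ⊗ₜ[ℂ] (T 1 : ℂ[T;T⁻¹]))) (sub_eq_zero.1 e)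
    simp only [mul_assoc, Algebra.TensorProduct.tmul_mul_tmul, mul_one, ← T_add] at e2
    exact e2

/-- The differential of the coinvariant `uv`, in terms of its coefficients. -/
theorem d_uv : TorusForms.d (TorusForms.ofTorus (Torus.mono 1 1 : Torus θ)) =
    ⟨0, (phase θ)⁻¹ • Torus.mono 0 1, Torus.mono 1 0, 0⟩ := by
  ext1 <;> simp

/-- A form `a + f du + g dv` with `f u = g v` is a combination of `1` and `d(uv)`. As
`d(uv) = exp (- i θ) v du + u dv`, the coefficient of `d(uv)` has to be `exp (i θ) f v⁻¹`. -/
theorem eq_add_mul_d_uv {ω : TorusForms θ} (h0 : ω.cuv = 0)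
    (h1 : ω.cu * Torus.mono 1 0 = ω.cv * Torus.mono 0 1) :
    ω = TorusForms.ofTorus ω.c + TorusForms.ofTorus (phase θ • (ω.cu * Torus.mono 0 (-1))) *
      TorusForms.d (TorusForms.ofTorus (Torus.mono 1 1)) := by
  have hq := phase_ne_zero θ
  have hv : ω.cv = ω.cu * Torus.mono 1 (-1) := by
    apply mul_mono_cancel 0 1
    rw [← h1, mul_assoc]
    simp
  rw [d_uv]
  ext1
  · simp
  · simp [mul_assoc, smul_smul, hq, ← Torus.one_eq]
  · simp [mul_assoc, smul_smul, hq, hv]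
  · simp [h0]

theorem uv_mem_coinvariants : Torus.mono 1 1 ∈ coinvariants (torusCoaction θ) := by
  rw [mem_coinvariants, torusCoaction_mono, sub_self, T_zero]

theorem d_uv_mem_baseForms :
    TorusForms.d (TorusForms.ofTorus (Torus.mono 1 1)) ∈ baseForms (formCoaction θ) :=
  formCoaction_isCoactionExtension.d_mem_baseForms
    (formCoaction_isCoactionExtension.incl_mem_baseForms uv_mem_coinvariants)

/-- Conversely the equations on the coefficients imply horizontality, since `d(uv)` is a base
form. -/
theorem mem_horizontalForms_iff {ω : TorusForms θ} : ω ∈ horizontalForms (formCoaction θ) ↔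
    ω.cuv = 0 ∧ ω.cu * Torus.mono 1 0 = ω.cv * Torus.mono 0 1 := by
  refine ⟨horizontal_coeff, fun ⟨h0, h1⟩ => ?_⟩
  have e := formCoaction_isCoactionExtension (θ := θ)
  rw [eq_add_mul_d_uv h0 h1]
  refine Submodule.add_mem _ ?_ ?_
  · rw [mem_horizontalForms, ← torus_incl, e.apply_incl, ← mul_one (tensorIncl _ _ _)]
    exact tensorIncl_mul_tprod_one_mem _ 1
  · rw [mem_horizontalForms, map_mul, ← torus_incl, e.apply_incl,
      mem_baseForms.1 d_uv_mem_baseForms]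
    exact tensorIncl_mul_tprod_one_mem _ _

theorem baseForms_le_horizontalForms {ω : TorusForms θ} (h : ω ∈ baseForms (formCoaction θ)) :
    ω ∈ horizontalForms (formCoaction θ) := by
  rw [mem_horizontalForms, mem_baseForms.1 h, ← one_mul (tprod _ _ _ _),
    ← map_one ((torusCalculus θ).tensorIncl circleCalculus)]
  exact tensorIncl_mul_tprod_one_mem _ _

theorem horizontalForms_eq : horizontalForms (formCoaction θ) = Submodule.span ℂ
    {ω | ∃ a : Torus θ, ∃ β ∈ baseForms (formCoaction θ), ∃ a' : Torus θ,
        ω = (torusCalculus θ).incl a * β * (torusCalculus θ).incl a'} := by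
  apply le_antisymm
  · intro ω hω
    obtain ⟨h0, h1⟩ := mem_horizontalForms_iff.1 hω
    rw [eq_add_mul_d_uv h0 h1]
    refine Submodule.add_mem _ (Submodule.subset_span ⟨ω.c, 1, one_mem _, 1, ?_⟩)
      (Submodule.subset_span
        ⟨phase θ • (ω.cu * Torus.mono 0 (-1)), _, d_uv_mem_baseForms, 1, ?_⟩)
    · rw [mul_one, map_one, mul_one, torus_incl]
    · rw [map_one, mul_one, torus_incl]
  · refine Submodule.span_le.2 ?_
    rintro ω ⟨a, β, hβ, a', rfl⟩
    obtain ⟨h0, h1⟩ := mem_horizontalForms_iff.1 (baseForms_le_horizontalForms hβ)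
    refine mem_horizontalForms_iff.2 ⟨by simp [torus_incl, h0], ?_⟩
    simp only [torus_incl, TorusForms.mul_cu, TorusForms.mul_cv, TorusForms.mul_c,
      TorusForms.ofTorus_cu, TorusForms.ofTorus_cv, TorusForms.ofTorus_c, mul_zero, zero_mul,
      zero_add, add_zero, mul_assoc, twistU_mul_u, twistV_mul_v]
    rw [← mul_assoc β.cu, h1, mul_assoc]

/-- A base form is `b + b' d(uv)` with coinvariant `b`, `b'`. It is horizontal, and coinvariance of
the coefficients follows by comparing the coefficients of `1 ⊗ 1` and `du ⊗ 1`. -/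
theorem exists_eq_of_mem_baseForms {ω : TorusForms θ} (h : ω ∈ baseForms (formCoaction θ)) :
    ω.c ∈ coinvariants (torusCoaction θ) ∧ ∃ f ∈ coinvariants (torusCoaction θ),
      ω = TorusForms.ofTorus ω.c +
        TorusForms.ofTorus f * TorusForms.d (TorusForms.ofTorus (Torus.mono 1 1)) := by
  obtain ⟨h0, h1⟩ := horizontal_coeff (baseForms_le_horizontalForms h)
  rw [mem_baseForms] at h
  constructor
  · have e := component_formCoaction coeffC_mul circleFst_mul ω
    rw [h, component_tprod] at e
    simp only [circleFst_apply, coeffC_apply, fst_one, fst_inl, fst_inr, TensorProduct.tmul_zero,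
      mul_zero, add_zero, sub_zero, TorusForms.mul_c, TorusForms.one_c, formU, formV,
      TensorProduct.zero_tmul, smul_zero, ← Algebra.TensorProduct.one_def, mul_one] at e
    exact e.symm
  · refine ⟨_, ?_, eq_add_mul_d_uv h0 h1⟩
    have e := component_formCoaction coeffU_mul circleFst_mul ω
    rw [h, component_tprod, h0] at e
    simp only [circleFst_apply, coeffU_apply, fst_one, fst_inl, fst_inr, TensorProduct.tmul_zero,
      mul_zero, add_zero, sub_zero, zero_add, TorusForms.one_cu, formU, formV, map_zero, zero_mul,
      TensorProduct.zero_tmul] at e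
    rw [mem_coinvariants, map_smul, map_mul, torusCoaction_mono, ← TensorProduct.smul_tmul']
    congr 1
    -- `e` says that the coefficient of `du` has weight `-1`, the opposite of the weight of `v⁻¹`
    have e2 := congrArg (· * ((Torus.mono 0 (-1) : Torus θ) ⊗ₜ[ℂ] (1 : ℂ[T;T⁻¹]))) e
    simp only [mul_assoc, Algebra.TensorProduct.tmul_mul_tmul, mul_one, one_mul] at e2
    exact e2.symm

theorem c_eq_zero_of_mem {n : ℕ} (hn : n ≠ 0) {ω : TorusForms θ}
    (h : ω ∈ (torusCalculus θ).grade n) : ω.c = 0 := by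
  rcases n with _ | _ | _ | n
  · exact absurd rfl hn
  · exact h.1
  · exact h.1
  · rw [TorusForms.mem_grade_add_three (n := n) |>.1 h, TorusForms.zero_c]

/-- A base form is horizontal, hence has no component along `du ∧ dv`. -/
theorem baseForms_inf_grade {n : ℕ} (hn : 2 ≤ n) :
    Subalgebra.toSubmodule (baseForms (formCoaction θ)) ⊓ (torusCalculus θ).grade n = ⊥ := by
  refine eq_bot_iff.2 ?_
  rintro ω ⟨h1, h2⟩
  obtain ⟨h0, -⟩ := horizontal_coeff (baseForms_le_horizontalForms h1)
  rcases n with _ | _ | _ | n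
  · omega
  · omega
  · obtain ⟨k0, k1, k2⟩ := TorusForms.mem_grade_two.1 h2
    change ω = 0
    ext1 <;> simp [*]
  · exact h2

theorem isPullbackCalculus : (torusCalculus θ).IsPullbackCalculus
    (coinvariants (torusCoaction θ)) (baseForms (formCoaction θ)) := by
  have hF := formCoaction_isCoactionExtension (θ := θ)
  have hgen : ∀ n, Subalgebra.toSubmodule (baseForms (formCoaction θ)) ⊓
      (torusCalculus θ).grade n =
        (torusCalculus θ).pullbackForms (coinvariants (torusCoaction θ)) n := by
    intro n
    refine le_antisymm ?_ (hF.pullbackForms_le n)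
    rintro ω ⟨hω, hn⟩
    obtain ⟨h0, f, hf, e⟩ := exists_eq_of_mem_baseForms hω
    rcases n with _ | _ | n
    · obtain ⟨k1, k2, k3⟩ := TorusForms.mem_grade_zero.1 hn
      refine Submodule.subset_span ⟨ω.c, h0, Fin.elim0, fun i => i.elim0, ?_⟩
      rw [List.ofFn_zero, List.prod_nil, mul_one, torus_incl]
      ext1 <;> simp [k1, k2, k3]
    · rw [c_eq_zero_of_mem one_ne_zero hn, map_zero, zero_add] at e
      refine Submodule.subset_span
        ⟨f, hf, fun _ => Torus.mono 1 1, fun _ => uv_mem_coinvariants, ?_⟩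
      rw [List.ofFn_succ, List.ofFn_zero, List.prod_cons, List.prod_nil, mul_one]
      exact e
    · have h := (baseForms_inf_grade (θ := θ) (n := n + 2) (by omega)).le ⟨hω, hn⟩
      rw [(Submodule.mem_bot ℂ).1 h]
      exact Submodule.zero_mem _
  refine ⟨?_, fun ω hω => hF.d_mem_baseForms hω, ?_, hgen⟩
  · intro ω hω n
    obtain ⟨h0, f, hf, e⟩ := exists_eq_of_mem_baseForms hω
    have m1 := (baseForms (formCoaction θ)).mul_mem (hF.incl_mem_baseForms hf)
      d_uv_mem_baseForms
    have g1 := ofTorus_mul_mem f ((torusCalculus θ).d_mem 0 _ (ofTorus_mem (Torus.mono 1 1)))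
    have k0 := (torusCalculus θ).decompose_mem (Subalgebra.toSubmodule (baseForms (formCoaction θ)))
      (ofTorus_mem ω.c) (hF.incl_mem_baseForms h0) n
    have k1 := (torusCalculus θ).decompose_mem (Subalgebra.toSubmodule (baseForms (formCoaction θ)))
      g1 m1 n
    have k := add_mem k0 k1
    rw [← Submodule.coe_add, ← DirectSum.add_apply, ← DirectSum.decompose_add, torus_d, ← e] at k
    exact k
  · apply le_antisymm
    · rintro ω ⟨hω, hn⟩
      obtain ⟨k1, k2, k3⟩ := TorusForms.mem_grade_zero.1 hn
      refine ⟨ω.c, (exists_eq_of_mem_baseForms hω).1, ?_⟩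
      change TorusForms.ofTorus ω.c = ω
      ext1 <;> simp [k1, k2, k3]
    · rintro ω ⟨b, hb, rfl⟩
      exact ⟨hF.incl_mem_baseForms hb, ofTorus_mem b⟩

/-! ### The connection form -/

/-- The `1`-form `u⁻¹ du`. -/
def logForm (θ : ℝ) : (torusCalculus θ).grade 1 :=
  ⟨TorusForms.ofTorus (Torus.mono (-1) 0) * formU θ, ofTorus_mul_mem _ formU_mem⟩

/-- `u⁻¹ du ↦ u⁻¹ du ⊗ 1 + 1 ⊗ t⁻¹ dt`. -/
theorem formCoaction_logForm : formCoaction θ (logForm θ) =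
    (torusCalculus θ).tprod circleCalculus (logForm θ) (inl 1) +
      (torusCalculus θ).tprod circleCalculus 1 (inr (T (-1))) := by
  have e : (logForm θ : TorusForms θ).cu = Torus.mono (-1) 0 := by simp [logForm, formU]
  have e1 : (logForm θ : TorusForms θ).c = 0 := by simp [logForm, formU]
  have e2 : (logForm θ : TorusForms θ).cv = 0 := by simp [logForm, formU]
  have e3 : (logForm θ : TorusForms θ).cuv = 0 := by simp [logForm, formU]
  rw [formCoaction_apply, e, e1, e2, e3, map_zero, zero_mul, zero_mul, zero_add, add_zero,
    add_zero, coactU, coactionHom_mono, mul_add, tprod_inl_mul _ _ _ _ formU_mem,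
    tprod_inl_mul _ _ _ _ (ofTorus_mem _), inl_T_mul_inl_T, inl_T_mul_inr_T, ← map_mul,
    Torus.mono_mul_mono, zero_mul, zpow_zero, one_smul, neg_add_cancel, add_zero, sub_zero,
    neg_add_cancel, ← Torus.one_eq, map_one, T_zero, add_zero]
  rfl

/-- The connection `t⁻¹ dt ↦ u⁻¹ du`. On `Λ¹` the scalar by which a form is a multiple of `t⁻¹ dt`
is the counit of its coefficient of `dt`. -/
def connection (θ : ℝ) (L : CircleForms →ₐ[ℂ] ℂ[T;T⁻¹] ⊗[ℂ] CircleForms) :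
    circleCalculus.leftCoinvariants L 1 →ₗ[ℂ] (torusCalculus θ).grade 1 :=
  LinearMap.toSpanSingleton ℂ _ (logForm θ) ∘ₗ circleCounitSnd ∘ₗ
    (circleCalculus.leftCoinvariants L 1).subtype

theorem connection_apply (L : CircleForms →ₐ[ℂ] ℂ[T;T⁻¹] ⊗[ℂ] CircleForms)
    (ϑ : circleCalculus.leftCoinvariants L 1) :
    connection θ L ϑ = circleCounitSnd ϑ • logForm θ := rfl

theorem circleCounitSnd_maurerCartan : circleCounitSnd (inr (T (-1))) = 1 := by
  rw [circleCounitSnd, LinearMap.comp_apply, circleSnd_apply, snd_inr, counit_T]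

theorem eq_smul_maurerCartan {L : CircleForms →ₐ[ℂ] ℂ[T;T⁻¹] ⊗[ℂ] CircleForms}
    (hL : circleCalculus.IsLeftCoaction L) (ϑ : circleCalculus.leftCoinvariants L 1) :
    (ϑ : CircleForms) = circleCounitSnd (ϑ : CircleForms) • inr (T (-1)) := by
  obtain ⟨ϑ, hϑ⟩ := ϑ
  rw [leftCoinvariants_one hL] at hϑ
  obtain ⟨r, rfl⟩ := Submodule.mem_span_singleton.1 hϑ
  change r • inr (T (-1)) = circleCounitSnd (r • inr (T (-1))) • (inr (T (-1)) : CircleForms)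
  rw [map_smul, circleCounitSnd_maurerCartan, smul_eq_mul, mul_one]

/-- `u⁻¹ du` is coinvariant, in accordance with the trivial adjoint coaction. -/
theorem rightCoaction_logForm :
    rightCoaction (formCoaction θ) (logForm θ) = (logForm θ : TorusForms θ) ⊗ₜ 1 := by
  rw [rightCoaction, LinearMap.comp_apply, LinearMap.comp_apply, AlgHom.toLinearMap_apply,
    formCoaction_logForm, map_add, map_add]
  change (logForm θ : TorusForms θ) ⊗ₜ circleCalculus.proj0 (circleCalculus.incl 1) +
    1 ⊗ₜ circleCalculus.proj0 (inr (T (-1))) = _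
  rw [proj0_incl, proj0_of_mem _ one_ne_zero (circle_inr_mem _), TensorProduct.tmul_zero, add_zero]

theorem verticalProj_logForm {L : CircleForms →ₐ[ℂ] ℂ[T;T⁻¹] ⊗[ℂ] CircleForms}
    (hL : circleCalculus.IsLeftCoaction L) :
    verticalProj (formCoaction θ) L (logForm θ) = 1 ⊗ₜ inr (T (-1)) := by
  rw [verticalProj, LinearMap.comp_apply, LinearMap.comp_apply, AlgHom.toLinearMap_apply,
    formCoaction_logForm, map_add, map_add]
  change (torusCalculus θ).proj0 (logForm θ) ⊗ₜ circleCalculus.coinvariantProj L (inl 1) +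
    (torusCalculus θ).proj0 ((torusCalculus θ).incl 1) ⊗ₜ
      circleCalculus.coinvariantProj L (inr (T (-1))) = _
  rw [proj0_incl, proj0_of_mem _ one_ne_zero (logForm θ).2, TensorProduct.zero_tmul, zero_add,
    coinvariantProj_inr hL]

theorem connection_isConnectionForm {L : CircleForms →ₐ[ℂ] ℂ[T;T⁻¹] ⊗[ℂ] CircleForms}
    (hL : circleCalculus.IsLeftCoaction L) :
    IsConnectionForm (formCoaction θ) L (connection θ L) where
  colinear := by
    refine ⟨_, isAdjointCoaction_trivial L, fun ϑ => ?_⟩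
    rw [connection_apply, Submodule.coe_smul, map_smul, rightCoaction_logForm,
      TensorProduct.smul_tmul']
    rfl
  splits ϑ := by
    rw [connection_apply, Submodule.coe_smul, map_smul, verticalProj_logForm hL,
      ← TensorProduct.tmul_smul, ← eq_smul_maurerCartan hL]

end NCTorus

end

theorem theorem6p1 (θ : ℝ) :
    -- the calculus on the torus is complete
    (torusCalculus θ).IsComplete circleCalculus (torusCoaction θ) ∧
    -- the calculus on the structure Hopf algebra is bicovariant
    circleCalculus.IsBicovariant ∧
    -- for the extended coaction `F` and the left coaction `L` on the forms of the circle
    ∀ F : TorusForms θ →ₐ[ℂ] (torusCalculus θ).Tensor circleCalculus,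
      (torusCalculus θ).IsCoactionExtension circleCalculus (torusCoaction θ) F →
    ∀ L : CircleForms →ₐ[ℂ] ℂ[T;T⁻¹] ⊗[ℂ] CircleForms, circleCalculus.IsLeftCoaction L →
      -- the base forms are the pullback calculus on `B`, and they vanish above degree `1`
      ((torusCalculus θ).IsPullbackCalculus (coinvariants (torusCoaction θ)) (baseForms F) ∧
        ∀ n, 2 ≤ n → Subalgebra.toSubmodule (baseForms F) ⊓ (torusCalculus θ).grade n = ⊥) ∧
      -- the left coinvariant forms are `ℂ ⊕ Λ¹` with `Λ¹` spanned by `t⁻¹ dt`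
      (circleCalculus.leftCoinvariants L 0 = Submodule.span ℂ {1} ∧
        circleCalculus.leftCoinvariants L 1 = Submodule.span ℂ
          {circleCalculus.incl (.T (-1)) * circleCalculus.d (circleCalculus.incl (.T 1))} ∧
        ∀ n, 2 ≤ n → circleCalculus.leftCoinvariants L n = ⊥) ∧
      -- the vertical forms
      ((∀ x, x ∈ verticalForms (Torus θ) circleCalculus L 0 ↔ ∃ a : Torus θ, x = a ⊗ₜ[ℂ] 1) ∧
        (∀ x, x ∈ verticalForms (Torus θ) circleCalculus L 1 ↔ ∃ a : Torus θ, x = a ⊗ₜ[ℂ]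
          (circleCalculus.incl (.T (-1)) * circleCalculus.d (circleCalculus.incl (.T 1)))) ∧
        ∀ n, 2 ≤ n → verticalForms (Torus θ) circleCalculus L n = ⊥) ∧
      -- the horizontal forms are `A Ω(B) A`
      horizontalForms F = Submodule.span ℂ {ω | ∃ a : Torus θ, ∃ β ∈ baseForms F, ∃ a' : Torus θ,
        ω = (torusCalculus θ).incl a * β * (torusCalculus θ).incl a'} ∧
      -- there is a unique linear map `t⁻¹ dt ↦ u⁻¹ du`, and it is a connection `1`-form
      ∃! s : circleCalculus.leftCoinvariants L 1 →ₗ[ℂ] (torusCalculus θ).grade 1,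
        (∀ ϑ : circleCalculus.leftCoinvariants L 1, (ϑ : CircleForms) =
            circleCalculus.incl (.T (-1)) * circleCalculus.d (circleCalculus.incl (.T 1)) →
          (s ϑ : TorusForms θ) = (torusCalculus θ).incl ((Torus.u⁻¹ : (Torus θ)ˣ) : Torus θ) *
            (torusCalculus θ).d ((torusCalculus θ).incl ((Torus.u : (Torus θ)ˣ) : Torus θ))) ∧
        IsConnectionForm F L s := by
  refine ⟨⟨formCoaction θ, formCoaction_isCoactionExtension⟩, circle_isBicovariant, ?_⟩
  intro F hF L hL
  obtain rfl := eq_formCoaction hF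
  refine ⟨⟨isPullbackCalculus, fun n hn => baseForms_inf_grade hn⟩,
    ⟨leftCoinvariants_zero hL, ?_, fun n hn => leftCoinvariants_of_two_le L hn⟩,
    ⟨mem_verticalForms_of_span (leftCoinvariants_zero hL), ?_,
      fun n hn => verticalForms_of_two_le _ L hn⟩, horizontalForms_eq, connection θ L, ⟨?_, ?_⟩, ?_⟩
  · rw [maurerCartan_eq]
    exact leftCoinvariants_one hL
  · rw [maurerCartan_eq]
    exact mem_verticalForms_of_span (leftCoinvariants_one hL)
  · intro ϑ h
    rw [maurerCartan_eq] at h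
    rw [connection_apply, h, circleCounitSnd_maurerCartan, one_smul]
    exact congrArg (TorusForms.ofTorus (Torus.mono (-1) 0) * ·) TorusForms.d_u.symm
  · exact connection_isConnectionForm hL
  · rintro s ⟨hs, -⟩
    rw [maurerCartan_eq] at hs
    ext1 ϑ
    have hm : TrivSqZeroExt.inr (LaurentPolynomial.T (-1)) ∈
        circleCalculus.leftCoinvariants L 1 := by
      rw [leftCoinvariants_one hL]
      exact Submodule.mem_span_singleton_self _
    have e : ϑ = circleCounitSnd (ϑ : CircleForms) • ⟨_, hm⟩ :=
      Subtype.ext (eq_smul_maurerCartan hL ϑ)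
    rw [connection_apply, e, map_smul, ← e]
    congr 1
    refine Subtype.ext ((hs ⟨_, hm⟩ rfl).trans ?_)
    exact congrArg (TorusForms.ofTorus (Torus.mono (-1) 0) * ·) TorusForms.d_u
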